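/- Let $k$ be a field of characteristic zero and $V$ a smooth scheme over $k$. A \emph{Rees algebra} over a scheme $V$ is a graded subalgebra $\mathcal G=\bigoplus_{n\ge 0} I_nW^n\subset\mathcal O_V[W]$, with $I_0=\mathcal O_V$ and each $I_n$ a sheaf of ideals, such that over every affine open $U$ it is of the form $\mathcal O_V(U)[f_1W^{n_1},\dots,f_sW^{n_s}]$ for finitely many $f_i\in\mathcal O_V(U)$ and $n_i\ge 1$. Its singular locus is $\operatorname{Sing}(\mathcal G)=\{x\in V: \nu_x(I_n)\ge n \text{ for every } n\ge 1\}$, where $\nu_x(I_n)\ge n$ means that $I_{n,x}\subset \mathfrak m_x^n$. A Rees algebra $\mathcal G=\bigoplus I_nW^n$ is a \emph{Diff-algebra} (relative to $k$) if $I_n\supset I_{n+1}$ for all $n$, and there is a covering of $V$ by affine open sets $U_i$ such that $D(h)\in I_{n-r}(U_i)$ for all $0\le r\le n$, every $h\in I_n(U_i)$ and every $k$-linear differential operator $D$ of order at most $r$ on $\mathcal O_V(U_i)$. For a Rees algebra $\mathcal G$ over a smooth $k$-scheme, $G(\mathcal G)$ denotes the smallest Diff-algebra containing $\mathcal G$.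 Let $\mathcal G$ be a Rees algebra over $V$, let $Y\subset V$ be a closed subscheme, smooth over $k$, with $Y\subset\operatorname{Sing}(\mathcal G)$, and let $\pi:V'\to V$ be the blow-up of $V$ along $Y$ (a permissible monoidal transformation). Let $I(H')=I(Y)\mathcal O_{V'}$ be the ideal sheaf of the exceptional hypersurface. The (weighted) transform of a Rees algebra $\bigoplus I_nW^n$ over $V$ is the Rees algebra $\bigoplus I'_nW^n$ over $V'$ determined by $I_n\mathcal O_{V'}=I(H')^nI'_n$ for all $n$. Then $G(\mathcal G)$ exists, $\pi$ is also permissible for $G(\mathcal G)$ (that is, $Y\subset\operatorname{Sing}(G(\mathcal G))$), the transforms $\mathcal G'$ and $G(\mathcal G)'$ of $\mathcal G$ and $G(\mathcal G)$ exist and are unique, $G(\mathcal G')$ and $G(G(\mathcal G)')$ exist, and $$\mathcal G'\subset G(\mathcal G)'\subset G(\mathcal G'),\qquad G(\mathcal G')=G\bigl(G(\mathcal G)'\bigr).$$ -/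

import Mathlib

open AlgebraicGeometry CategoryTheory Polynomial

universe u

noncomputable section

/-! ### Differential operators -/

/-- `IsDiffOp k r D`: the `k`-linear endomorphism `D` of the `k`-algebra `A` is a differential
operator of order at most `r` (in the sense of Grothendieck): all commutators `[D, a]` with
multiplication operators vanish if `r = 0`, and have order at most `r - 1` if `r > 0`. -/
def IsDiffOp (k : Type*) {A : Type*} [CommRing k] [CommRing A] [Algebra k A] :
    ℕ → (A →ₗ[k] A) → Prop
  | 0, D => ∀ a : A, D ∘ₗ LinearMap.mulLeft k a - LinearMap.mulLeft k a ∘ₗ D = 0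
  | r + 1, D => ∀ a : A,
      IsDiffOp k r (D ∘ₗ LinearMap.mulLeft k a - LinearMap.mulLeft k a ∘ₗ D)

/-- The `k`-algebra structure on `Γ(V, U)` given by a structure morphism `f : V ⟶ Spec k`. -/
@[reducible]
def sectionAlgebra {k : Type u} [Field k] {V : Scheme.{u}} (f : V ⟶ Spec (.of k))
    (U : V.Opens) : Algebra k Γ(V, U) :=
  ((Scheme.ΓSpecIso (.of k)).inv ≫ f.appLE ⊤ U le_top).hom.toAlgebra

/-! ### Rees algebras over a scheme -/

/-- A Rees algebra `⨁ Iₙ Wⁿ ⊆ 𝒪_V[W]` over the scheme `V`: a graded subalgebra with `I₀ = 𝒪_V`,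
each `Iₙ` a (quasi-coherent) sheaf of ideals, such that over every affine open `U` it is
`𝒪_V(U)[f₁ W^{n₁}, …, fₛ W^{nₛ}]` for finitely many `fᵢ ∈ 𝒪_V(U)` and `nᵢ ≥ 1`. -/
@[ext]
structure ReesAlg (V : Scheme.{u}) where
  /-- The sheaf of ideals in degree `n`. -/
  I : ℕ → V.IdealSheafData
  I_zero : I 0 = ⊤
  mul_le : ∀ m n, I m * I n ≤ I (m + n)
  finite_gen : ∀ U : V.affineOpens, ∃ F : Finset (Γ(V, U) × ℕ),
    (∀ p ∈ F, 1 ≤ p.2) ∧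
    ∀ q : Γ(V, U)[X],
      q ∈ Algebra.adjoin Γ(V, U) ((fun p : Γ(V, U) × ℕ => monomial p.2 p.1) '' (F : Set _)) ↔
        ∀ n, q.coeff n ∈ (I n).ideal U

/-- Inclusion of Rees algebras, as subalgebras of `𝒪_V[W]`. -/
instance (V : Scheme.{u}) : PartialOrder (ReesAlg V) :=
  PartialOrder.lift ReesAlg.I fun _ _ => ReesAlg.ext

/-- `ν_x(J) ≥ n`, i.e. the stalk of `J` at `x` is contained in the `n`-th power of the maximal
ideal of `𝒪_{V,x}`. -/
def OrderAtLeast {V : Scheme.{u}} (J : V.IdealSheafData) (x : V) (n : ℕ) : Prop :=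
  ∀ (U : V.affineOpens) (hx : x ∈ U.1),
    (J.ideal U).map (V.presheaf.germ U.1 x hx).hom ≤
      IsLocalRing.maximalIdeal (V.presheaf.stalk x) ^ n

/-- The singular locus of a Rees algebra. -/
def ReesAlg.Sing {V : Scheme.{u}} (𝒢 : ReesAlg V) : Set V :=
  {x | ∀ n, 1 ≤ n → OrderAtLeast (𝒢.I n) x n}

/-- `𝒢` is a differential Rees algebra (Diff-algebra) relative to `k`. -/
structure IsDiffAlgebra {k : Type u} [Field k] {V : Scheme.{u}} (f : V ⟶ Spec (.of k))
    (𝒢 : ReesAlg V) : Prop where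
  succ_le : ∀ n, 𝒢.I (n + 1) ≤ 𝒢.I n
  /-- There is a covering by affine open sets on which differential operators of order at most
  `r` send `Iₙ` to `Iₙ₋ᵣ`. -/
  diff_mem : ∀ x : V, ∃ U : V.affineOpens, x ∈ U.1 ∧
    letI := sectionAlgebra f U.1
    ∀ (r n : ℕ), r ≤ n → ∀ D : Γ(V, U) →ₗ[k] Γ(V, U), IsDiffOp k r D →
      ∀ h ∈ (𝒢.I n).ideal U, D h ∈ (𝒢.I (n - r)).ideal U

/-- `𝒟` is `G(𝒢)`, the smallest Diff-algebra containing the Rees algebra `𝒢`. -/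
def IsDiffHull {k : Type u} [Field k] {V : Scheme.{u}} (f : V ⟶ Spec (.of k))
    (𝒢 𝒟 : ReesAlg V) : Prop :=
  IsLeast {𝒦 : ReesAlg V | IsDiffAlgebra f 𝒦 ∧ 𝒢 ≤ 𝒦} 𝒟

/-! ### Blow-ups -/

section ReesGrading

variable {A : Type u} [CommRing A] (J : Ideal A)

/-- The degree `n` part `Jⁿ tⁿ` of the Rees ring `A[J t] = ⨁ Jⁿ tⁿ` of an ideal. -/
def reesGrading (n : ℕ) : Submodule A (reesAlgebra J) :=
  (LinearMap.range (monomial n : A →ₗ[A] A[X])).comap (reesAlgebra J).val.toLinearMap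

theorem mem_reesGrading {n : ℕ} {p : reesAlgebra J} :
    p ∈ reesGrading J n ↔ ∃ a : A, monomial n a = (p : A[X]) := Iff.rfl

/-- The degree `n` component of an element of the Rees ring. -/
def reesComponent (n : ℕ) (p : reesAlgebra J) : reesGrading J n :=
  ⟨⟨monomial n ((p : A[X]).coeff n), reesAlgebra.monomial_mem.mpr (p.2 n)⟩,
    (mem_reesGrading J).mpr ⟨_, rfl⟩⟩

instance reesGrading_setLike : SetLike.GradedMonoid (reesGrading J) where
  one_mem := (mem_reesGrading J).mpr ⟨1, by simp⟩
  mul_mem := by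
    rintro i j p q hp hq
    obtain ⟨a, ha⟩ := (mem_reesGrading J).mp hp
    obtain ⟨b, hb⟩ := (mem_reesGrading J).mp hq
    exact (mem_reesGrading J).mpr ⟨a * b, by
      rw [← monomial_mul_monomial, ha, hb]; rfl⟩

/-- The homogeneous components of an element of the Rees ring. -/
def reesDecompose (p : reesAlgebra J) : DirectSum ℕ fun n => reesGrading J n :=
  DirectSum.mk (fun n => reesGrading J n) (p : A[X]).support fun n => reesComponent J n p

theorem coe_reesDecompose (p : reesAlgebra J) (n : ℕ) :
    ((reesDecompose J p n : reesAlgebra J) : A[X]) = monomial n ((p : A[X]).coeff n) := by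
  by_cases h : n ∈ (p : A[X]).support
  · rw [reesDecompose, DirectSum.mk_apply_of_mem h]
    rfl
  · rw [reesDecompose, DirectSum.mk_apply_of_notMem h, notMem_support_iff.mp h]
    simp

theorem coeff_coeAddMonoidHom (x : DirectSum ℕ fun n => reesGrading J n) (n : ℕ) :
    monomial n (((DirectSum.coeAddMonoidHom (reesGrading J) x : reesAlgebra J) : A[X]).coeff n) =
      ((x n : reesAlgebra J) : A[X]) := by
  induction x using DirectSum.induction_on with
  | zero => simp
  | of i y =>
    rw [DirectSum.coeAddMonoidHom_of]
    obtain ⟨a, ha⟩ := (mem_reesGrading J).mp y.2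
    rw [← ha, coeff_monomial]
    split_ifs with h
    · subst h
      rw [ha, DirectSum.of_eq_same]
    · rw [DirectSum.of_eq_of_ne _ _ _ (Ne.symm h)]
      simp
  | add x y hx hy =>
    rw [map_add, Subalgebra.coe_add, coeff_add, map_add, hx, hy]
    rfl

instance reesGrading_gradedAlgebra : GradedAlgebra (reesGrading J) where
  decompose' := reesDecompose J
  left_inv p := by
    ext n
    have h := coeff_coeAddMonoidHom J (reesDecompose J p) n
    rw [coe_reesDecompose] at h
    exact monomial_injective n h
  right_inv x := by
    refine DFinsupp.ext fun n => Subtype.ext (Subtype.ext ?_)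
    exact (coe_reesDecompose J _ n).trans (coeff_coeAddMonoidHom J x n)

end ReesGrading

/-- The structure morphism `Proj (⨁ Jⁿ) ⟶ Spec A`. -/
def projReesToSpec {A : Type u} [CommRing A] (J : Ideal A) :
    Proj (reesGrading J) ⟶ Spec (.of A) :=
  Proj.toSpecZero (reesGrading J) ≫
    Spec.map (CommRingCat.ofHom (algebraMap A (reesGrading J 0)))

/-- `π : V' ⟶ V` is the blow-up (monoidal transformation) of `V` along the closed subscheme with
ideal sheaf `Z`: over each affine open `U` it is `Proj (⨁ Z(U)ⁿ) ⟶ Spec 𝒪_V(U) ≅ U`. -/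
def IsBlowup {V V' : Scheme.{u}} (π : V' ⟶ V) (Z : V.IdealSheafData) : Prop :=
  ∀ U : V.affineOpens, ∃ e : (π ⁻¹ᵁ U.1).toScheme ≅ Proj (reesGrading (Z.ideal U)),
    e.hom ≫ projReesToSpec (Z.ideal U) = (π ∣_ U.1) ≫ U.2.isoSpec.hom

/-- `𝒢'` is the weighted transform of `𝒢` by the blow-up `π` along `Z`: with
`I(H') = Z 𝒪_{V'}` the ideal sheaf of the exceptional hypersurface,
`Iₙ 𝒪_{V'} = I(H')ⁿ I'ₙ` for every `n`. -/
def IsWeightedTransform {V V' : Scheme.{u}} (π : V' ⟶ V) (Z : V.IdealSheafData)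
    (𝒢 : ReesAlg V) (𝒢' : ReesAlg V') : Prop :=
  ∀ n, (𝒢.I n).comap π = Z.comap π ^ n * 𝒢'.I n

end

/-!
# Differential hulls of Rees algebras and permissible monoidal transformations

The theorem rests on two facts about derivations.

*Derivations suffice.* In characteristic zero a decreasing sequence of ideals `Iₙ` such that
derivations map `Iₙ₊₁` to `Iₙ` satisfies `D (Iₙ) ⊆ Iₙ₋ᵣ` for all differential operators `D` of
order at most `r` (`DerivationClosed.diffOp_mem`). This follows from Euler's identity
`∑ i, [D, xᵢ] ∘ δᵢ ≡ r D` modulo operators of lower order, where `da = ∑ i, δᵢ(a) dxᵢ` for a dual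
basis `(xᵢ, δᵢ)` of the differentials; it uses only that the module of differentials is projective.
Stability under derivations is inherited by localizations and is local, so a Diff-algebra is given
on every affine open set by a family of ideals stable under derivations (`isDiffAlgebra_iff`),
and the smallest such families containing a Rees algebra glue to `G(𝒢)` (`ReesAlg.diffHull`). A Rees algebra with
generators `f Wᴺ` has a hull generated by the `g Wᵐ`, `m ≥ 1`, with `g` obtained from `f` by
applying at most `N - m` of the `δᵢ`; hence the hull is finitely generated (`IsFGFamily.diffHull`).

*Derivations lift to the blow-up after multiplication by an equation of the exceptional divisor.*
On an affine chart `A → B = A[J / a]` of the blow-up, `a D` extends to a derivation of `B` for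
every derivation `D` of `A`. If `⨁ Eₙ Wⁿ` is a Diff-algebra over `B`, the identity
`D (aⁿ⁺¹ e) = (n + 1) aⁿ D(a) e + aⁿ (a D)(e)` shows that the ideals `{x ∈ A | x ∈ aⁿ Eₙ}` form a
differential family (`IsBlowupChart.isDiffFamily_comap`). If `E` contains the transform `𝒢'` then
this family contains `𝒢`, hence `G(𝒢)`, which means that `E` contains `G(𝒢)'`
(`ReesAlg.weightedTransform_diffHull_le`). With `E = G(𝒢')` this is `G(𝒢)' ⊆ G(𝒢')`, and the
equality of hulls is formal.

Both facts are applied on the blow-up `V'` as well, so its differentials have to be locally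
projective. They are: near the center, the ideal `J` is generated by part of a coordinate system
(`exists_coordinates`), and then a dual basis on the chart can be written down
(`IsBlowupChart.hasProjectiveKaehler`).

Permissibility of `π` for `G(𝒢)` holds because the preimages in `A` of the powers of the maximal
ideal of a local ring `A_p` form a differential family (`isDiffFamily_symbolicPow`). The transforms
exist because `ν_x(Iₙ) ≥ n` along the smooth center `Y` implies `Iₙ ⊆ I(Y)ⁿ`
(`mem_pow_of_forall_mem_symbolicPow`): the conormal sequence of `Y` splits, so for generators `fᵢ`
of `I(Y)` there are derivations `θᵢ` with `g ≡ ∑ i, θᵢ(g) fᵢ` modulo `I(Y)²` for `g ∈ I(Y)`, and the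
vector field `∑ i, fᵢ θᵢ` acts on `I(Y)ⁿ / I(Y)ⁿ⁺¹` as multiplication by `n`. So `I'ₙ` can be
defined as the quotient `(Iₙ 𝒪_{V'} : I(H')ⁿ)`, and it is the only possible choice since `I(H')` is
invertible.
-/

noncomputable section

open KaehlerDifferential

/-! ### Dual bases of Kähler differentials -/

section DualBasis

variable {k A : Type*} [CommRing k] [CommRing A] [Algebra k A]

/-- Elements `x i` of the `k`-algebra `A` and derivations `δ i` of `A` form a (not necessarily
linearly independent) dual basis of `Ω[A⁄k]` if `da = ∑ i, δ i (a) d(x i)` for all `a`. -/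
def IsKaehlerDualBasis {ι : Type*} [Fintype ι] (x : ι → A) (δ : ι → Derivation k A A) : Prop :=
  ∀ a, D k A a = ∑ i, δ i a • D k A (x i)

/-- `A` is finitely generated over `k`, and its module of differentials is projective. -/
structure HasProjectiveKaehler (k A : Type*) [CommRing k] [CommRing A] [Algebra k A] : Prop where
  finiteType : Algebra.FiniteType k A
  projective : Module.Projective A Ω[A⁄k]

theorem IsKaehlerDualBasis.apply_eq_sum {ι : Type*} [Fintype ι] {x : ι → A}
    {δ : ι → Derivation k A A} (h : IsKaehlerDualBasis x δ) {M : Type*} [AddCommGroup M]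
    [Module A M] [Module k M] [IsScalarTower k A M] (E : Derivation k A M) (a : A) :
    E a = ∑ i, δ i a • E (x i) := by
  have := congrArg E.liftKaehlerDifferential (h a)
  simpa using this

theorem HasProjectiveKaehler.exists_dualBasis (h : HasProjectiveKaehler k A) :
    ∃ (n : ℕ) (x : Fin n → A) (δ : Fin n → Derivation k A A), IsKaehlerDualBasis x δ := by
  have := h.finiteType
  have := h.projective
  have hfg : (Submodule.span A (Set.range (D k A))).FG := by
    rw [KaehlerDifferential.span_range_derivation]
    exact Module.Finite.fg_top
  obtain ⟨s, hs, hs'⟩ := (Submodule.fg_span_iff_fg_span_finset_subset _).mp hfg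
  rw [KaehlerDifferential.span_range_derivation] at hs'
  have hx : ∀ i : Fin s.card, ∃ y, D k A y = (s.equivFin.symm i : Ω[A⁄k]) :=
    fun i => hs (s.equivFin.symm i).2
  choose x hx using hx
  let p : (Fin s.card → A) →ₗ[A] Ω[A⁄k] := Fintype.linearCombination A fun i => D k A (x i)
  have hp : Function.Surjective p := by
    rw [← LinearMap.range_eq_top, Fintype.range_linearCombination, eq_top_iff, hs']
    refine Submodule.span_mono fun w hw => ⟨s.equivFin ⟨w, hw⟩, ?_⟩
    simp [hx]
  obtain ⟨σ, hσ⟩ := Module.projective_lifting_property p LinearMap.id hp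
  refine ⟨s.card, x, fun i => ((LinearMap.proj i).comp σ).compDer (D k A), fun a => ?_⟩
  have := LinearMap.congr_fun hσ (D k A a)
  simpa [p, Fintype.linearCombination_apply] using this.symm

theorem IsKaehlerDualBasis.projective {ι : Type*} [Fintype ι] {x : ι → A}
    {δ : ι → Derivation k A A} (h : IsKaehlerDualBasis x δ) : Module.Projective A Ω[A⁄k] := by
  refine Module.Projective.of_split (M := ι → A)
    (LinearMap.pi fun i => (δ i).liftKaehlerDifferential)
    (Fintype.linearCombination A fun i => D k A (x i)) ?_
  apply Derivation.liftKaehlerDifferential_unique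
  ext a
  simpa [Fintype.linearCombination_apply] using (h a).symm

theorem Algebra.Smooth.hasProjectiveKaehler [Algebra.Smooth k A] : HasProjectiveKaehler k A :=
  ⟨inferInstance, inferInstance⟩

end DualBasis

/-! ### Differential operators and Euler's identity -/

section DiffOp

variable {k A : Type*} [CommRing k] [CommRing A] [Algebra k A]

/-- The commutator `[E, a]` of a `k`-linear endomorphism with a multiplication operator. -/
def mulComm (E : A →ₗ[k] A) (a : A) : A →ₗ[k] A :=
  E ∘ₗ LinearMap.mulLeft k a - LinearMap.mulLeft k a ∘ₗ E

@[simp] theorem mulComm_apply (E : A →ₗ[k] A) (a b : A) :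
    mulComm E a b = E (a * b) - a * E b := rfl

/-- The order filtration of differential operators with a shifted index: `diffFiltration k A r`
consists of the operators of order less than `r`. -/
def diffFiltration (k A : Type*) [CommRing k] [CommRing A] [Algebra k A] :
    ℕ → Submodule A (A →ₗ[k] A)
  | 0 => ⊥
  | r + 1 =>
    { carrier := {E | ∀ a, mulComm E a ∈ diffFiltration k A r}
      add_mem' := fun {E E'} h h' a => by
        have : mulComm (E + E') a = mulComm E a + mulComm E' a := by
          ext b; simp; ring
        rw [this]; exact add_mem (h a) (h' a)
      zero_mem' := fun a => by
        have : mulComm (0 : A →ₗ[k] A) a = 0 := by ext b; simp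
        rw [this]; exact zero_mem _
      smul_mem' := fun c E h a => by
        have : mulComm (c • E) a = c • mulComm E a := by ext b; simp; ring
        rw [this]; exact Submodule.smul_mem _ _ (h a) }

theorem mem_diffFiltration_succ {r : ℕ} {E : A →ₗ[k] A} :
    E ∈ diffFiltration k A (r + 1) ↔ ∀ a, mulComm E a ∈ diffFiltration k A r := Iff.rfl

theorem isDiffOp_iff_mem_diffFiltration {r : ℕ} {E : A →ₗ[k] A} :
    IsDiffOp k r E ↔ E ∈ diffFiltration k A (r + 1) := by
  induction r generalizing E with
  | zero => exact Iff.rfl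
  | succ r ih => exact forall_congr' fun a => ih

theorem Derivation.isDiffOp_one (E : Derivation k A A) : IsDiffOp k 1 (E : A →ₗ[k] A) := by
  intro a b
  ext c
  simp
  ring_nf

/-- Modulo operators of order less than `r`, the commutator `[E, a]` of an operator `E` of order
at most `r + 1` is a derivation in `a`. -/
def symbolDerivation {r : ℕ} (E : A →ₗ[k] A) (hE : E ∈ diffFiltration k A (r + 2)) :
    Derivation k A ((A →ₗ[k] A) ⧸ diffFiltration k A r) :=
  Derivation.mk'
    { toFun := fun a => Submodule.Quotient.mk (mulComm E a)
      map_add' := fun a b => by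
        rw [← Submodule.Quotient.mk_add]; congr 1; ext c; simp [add_mul]; ring
      map_smul' := fun t a => by
        rw [← Submodule.Quotient.mk_smul]; congr 1; ext c; simp [smul_sub] }
    fun a b => by
      simp only [LinearMap.coe_mk, AddHom.coe_mk]
      rw [← Submodule.Quotient.mk_smul, ← Submodule.Quotient.mk_smul, ← Submodule.Quotient.mk_add,
        Submodule.Quotient.eq]
      convert mem_diffFiltration_succ.mp (mem_diffFiltration_succ.mp hE a) b using 1
      ext c
      simp
      ring_nf

theorem IsKaehlerDualBasis.sum_smul_mulComm_sub_mem {ι : Type*} [Fintype ι] {x : ι → A}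
    {δ : ι → Derivation k A A} (h : IsKaehlerDualBasis x δ) {r : ℕ} {E : A →ₗ[k] A}
    (hE : E ∈ diffFiltration k A (r + 2)) (a : A) :
    ∑ i, δ i a • mulComm E (x i) - mulComm E a ∈ diffFiltration k A r := by
  have := h.apply_eq_sum (symbolDerivation E hE) a
  rw [← Submodule.Quotient.eq]
  refine Eq.trans ?_ this.symm
  rw [← Submodule.mkQ_apply, map_sum]
  rfl

/-- Euler's identity for principal symbols: if `E` has order at most `r`, then
`∑ i, [E, x i] ∘ δ i - r E` has order less than `r`. -/
theorem IsKaehlerDualBasis.euler_mem {ι : Type*} [Fintype ι] {x : ι → A}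
    {δ : ι → Derivation k A A} (h : IsKaehlerDualBasis x δ) {r : ℕ} {E : A →ₗ[k] A}
    (hE : E ∈ diffFiltration k A (r + 1)) :
    ∑ i, mulComm E (x i) ∘ₗ (δ i : A →ₗ[k] A) - (r : A) • E ∈ diffFiltration k A r := by
  induction r generalizing E with
  | zero =>
    have h0 : ∀ a, mulComm E a = 0 := hE
    simp [h0, diffFiltration]
  | succ r ih =>
    intro a
    have h1 := ih (mem_diffFiltration_succ.mp hE a)
    have h2 := h.sum_smul_mulComm_sub_mem hE a
    have h3 : ∑ i, mulComm (mulComm E (x i)) (δ i a) ∈ diffFiltration k A r :=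
      Submodule.sum_mem _ fun i _ =>
        mem_diffFiltration_succ.mp (mem_diffFiltration_succ.mp hE (x i)) (δ i a)
    -- the commutator of the left-hand side with `a` is the sum of three terms of lower order
    convert add_mem (add_mem h1 h2) h3 using 1
    ext c
    simp only [mulComm_apply, LinearMap.sub_apply, LinearMap.sum_apply, LinearMap.add_apply,
      LinearMap.smul_apply, LinearMap.comp_apply, Derivation.coeFn_coe, Derivation.leibniz,
      smul_eq_mul, Nat.cast_add, Nat.cast_one]
    have key : ∀ i, E (x i * (a * δ i c + c * δ i a)) - x i * E (a * δ i c + c * δ i a) -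
        a * (E (x i * δ i c) - x i * E (δ i c)) =
        (E (a * (x i * δ i c)) - a * E (x i * δ i c) - x i * (E (a * δ i c) - a * E (δ i c))) +
        (δ i a * (E (x i * c) - x i * E c)) +
        (E (x i * (δ i a * c)) - x i * E (δ i a * c) - δ i a * (E (x i * c) - x i * E c)) := by
      intro i
      rw [mul_add, map_add, map_add, mul_left_comm (x i) a, mul_comm c (δ i a)]
      ring
    have := Finset.sum_congr rfl fun i (_ : i ∈ Finset.univ) => key i
    simp only [Finset.sum_sub_distrib, Finset.sum_add_distrib] at this ⊢
    simp only [mul_add, map_add, mul_sub, Finset.mul_sum, Finset.sum_add_distrib,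
      Finset.sum_sub_distrib] at this ⊢
    linear_combination this

end DiffOp

/-! ### Stability under derivations -/

section DiffClosed

theorem Ideal.mem_of_natCast_succ_mul_mem (k : Type*) {A : Type*} [Field k] [CharZero k]
    [CommRing A] [Algebra k A] {I : Ideal A} {n : ℕ} {a : A} (h : ((n + 1 : ℕ) : A) * a ∈ I) :
    a ∈ I := by
  have h4 : algebraMap k A ((n + 1 : ℕ) : k)⁻¹ * (((n + 1 : ℕ) : A) * a) ∈ I :=
    Ideal.mul_mem_left _ _ h
  rwa [← mul_assoc, ← map_natCast (algebraMap k A), ← map_mul,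
    inv_mul_cancel₀ (Nat.cast_ne_zero.mpr n.succ_ne_zero), map_one, one_mul] at h4

/-- A family of ideals `I n` is closed under derivations if every `k`-derivation maps `I (n + 1)`
to `I n`. -/
def DerivationClosed (k : Type*) {A : Type*} [CommRing k] [CommRing A] [Algebra k A]
    (I : ℕ → Ideal A) : Prop :=
  ∀ (E : Derivation k A A) (n : ℕ), ∀ h ∈ I (n + 1), E h ∈ I n

variable {k A : Type*} [Field k] [CharZero k] [CommRing A] [Algebra k A]

/-- In characteristic zero, a decreasing family of ideals closed under derivations is closed under
all differential operators: by Euler's identity an operator of order `r` is, up to the factor `r`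
and operators of lower order, a sum of compositions of an operator of order `r - 1` with a
derivation. -/
theorem DerivationClosed.diffOp_mem (hA : HasProjectiveKaehler k A) {I : ℕ → Ideal A}
    (hI : DerivationClosed k I) (hanti : ∀ n, I (n + 1) ≤ I n) {r n : ℕ} (hrn : r ≤ n)
    {E : A →ₗ[k] A} (hE : IsDiffOp k r E) {h : A} (hh : h ∈ I n) : E h ∈ I (n - r) := by
  obtain ⟨m, x, δ, hx⟩ := hA.exists_dualBasis
  rw [isDiffOp_iff_mem_diffFiltration] at hE
  have hanti' : Antitone I := antitone_nat_of_succ_le hanti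
  induction r generalizing n E h with
  | zero =>
    -- an operator of order zero is multiplication by its value at `1`
    have h0 : mulComm E h = 0 := hE h
    have := LinearMap.congr_fun h0 1
    simp [sub_eq_zero] at this
    rw [this]
    exact Ideal.mul_mem_right _ _ hh
  | succ r ih =>
    obtain ⟨n, rfl⟩ : ∃ m, n = m + 1 := ⟨n - 1, by omega⟩
    have h1 := ih (by omega) (hx.euler_mem hE) hh
    have h2 : ∑ i, mulComm E (x i) (δ i h) ∈ I (n - r) :=
      Submodule.sum_mem _ fun i _ => ih (by omega) (hE (x i)) (hI (δ i) n h hh)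
    have h3 : ((r + 1 : ℕ) : A) * E h ∈ I (n - r) := by
      have := sub_mem h2 (hanti' (show n - r ≤ n + 1 - r by omega) h1)
      simpa using this
    rw [show n + 1 - (r + 1) = n - r by omega]
    exact Ideal.mem_of_natCast_succ_mul_mem k h3

end DiffClosed

/-! ### Derivations along the ideal of a smooth center -/

section Conormal

variable {k A : Type*} [CommRing k] [CommRing A] [Algebra k A]

theorem Derivation.apply_mem_pow (E : Derivation k A A) (J : Ideal A) {n : ℕ} {h : A}
    (hh : h ∈ J ^ (n + 1)) : E h ∈ J ^ n := by
  induction n generalizing h with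
  | zero => simp
  | succ n ih =>
    rw [pow_succ] at hh
    refine Submodule.mul_induction_on hh (fun a ha b hb => ?_) fun a b ha hb => ?_
    · rw [E.leibniz, smul_eq_mul, smul_eq_mul]
      refine add_mem (Ideal.mul_mem_right _ _ ha) ?_
      rw [mul_comm, pow_succ]
      exact Ideal.mul_mem_mul (ih ha) hb
    · rw [map_add]; exact add_mem ha hb

/-- The splitting of the conormal sequence of `A → A ⧸ J`, in terms of derivations: for generators
`f i` of `J` there are derivations `θ i` of `A` with `g ≡ ∑ i, θ i (g) f i` modulo `J ^ 2` for all
`g ∈ J`. -/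
theorem exists_derivation_sum_sub_mem_sq [Algebra.FormallySmooth k A] (J : Ideal A)
    [Algebra.FormallySmooth k (A ⧸ J)] {ι : Type*} [Fintype ι] (f : ι → A)
    (hf : Ideal.span (Set.range f) = J) :
    ∃ θ : ι → Derivation k A A, ∀ g ∈ J, ∑ i, θ i g * f i - g ∈ J ^ 2 := by
  obtain ⟨l, hl⟩ := (Algebra.FormallySmooth.iff_split_injection (R := k) (P := A) (A := A ⧸ J)
    Ideal.Quotient.mk_surjective).mp ‹_›
  have hker : RingHom.ker (algebraMap A (A ⧸ J)) = J := Ideal.mk_ker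
  have hfker : ∀ i, f i ∈ RingHom.ker (algebraMap A (A ⧸ J)) := fun i => by
    rw [hker, ← hf]; exact Ideal.subset_span ⟨i, rfl⟩
  let K := RingHom.ker (algebraMap A (A ⧸ J))
  let p : (ι → A) →ₗ[A] K.Cotangent :=
    Fintype.linearCombination A fun i => K.toCotangent ⟨f i, hfker i⟩
  have hp : Function.Surjective p := by
    intro y
    obtain ⟨⟨g, hg⟩, rfl⟩ := K.toCotangent_surjective y
    have hg' : g ∈ Submodule.span A (Set.range f) := by
      exact hf.ge (hker.le hg)
    obtain ⟨c, rfl⟩ := (Submodule.mem_span_range_iff_exists_fun A).mp hg'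
    refine ⟨c, ?_⟩
    simp only [p, Fintype.linearCombination_apply, ← map_smul, ← map_sum]
    congr 1
    ext
    simp
  let lam : Ω[A⁄k] →ₗ[A] K.Cotangent := l ∘ₗ (TensorProduct.mk A (A ⧸ J) Ω[A⁄k] 1)
  obtain ⟨σ, hσ⟩ := Module.projective_lifting_property p lam hp
  refine ⟨fun i => ((LinearMap.proj i).comp σ).compDer (D k A), fun g hg => ?_⟩
  have hgK : g ∈ K := hker.ge hg
  have h1 := LinearMap.congr_fun hσ (D k A g)
  have h2 := LinearMap.congr_fun hl (K.toCotangent ⟨g, hgK⟩)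
  rw [LinearMap.comp_apply, kerCotangentToTensor_toCotangent] at h2
  have h3 : p (σ (D k A g)) = K.toCotangent ⟨g, hgK⟩ := h1.trans h2
  simp only [p, Fintype.linearCombination_apply, ← map_smul, ← map_sum] at h3
  rw [Ideal.toCotangent_eq] at h3
  have h4 : (K ^ 2 : Ideal A) = J ^ 2 := congrArg (· ^ 2) hker
  rw [h4] at h3
  simpa using h3

/-- Euler's identity along `J`: the vector field `∑ i, f i θ i` acts on `J ^ n ⧸ J ^ (n + 1)` as
multiplication by `n`. -/
theorem sum_derivation_mul_sub_mem_pow {J : Ideal A} {ι : Type*} [Fintype ι] {f : ι → A}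
    (hf : ∀ i, f i ∈ J) {θ : ι → Derivation k A A}
    (hθ : ∀ g ∈ J, ∑ i, θ i g * f i - g ∈ J ^ 2) {n : ℕ} {h : A} (hh : h ∈ J ^ n) :
    ∑ i, θ i h * f i - n * h ∈ J ^ (n + 1) := by
  induction n generalizing h with
  | zero =>
    simpa using Submodule.sum_mem J fun i _ => Ideal.mul_mem_left J (θ i h) (hf i)
  | succ n ih =>
    rw [pow_succ] at hh
    refine Submodule.mul_induction_on hh (fun a ha b hb => ?_) fun a b ha hb => ?_
    · have h1 : b * (∑ i, θ i a * f i - n * a) ∈ J ^ (n + 1 + 1) := by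
        rw [mul_comm, pow_succ]; exact Ideal.mul_mem_mul (ih ha) hb
      have h2 : a * (∑ i, θ i b * f i - b) ∈ J ^ (n + 1 + 1) := by
        rw [add_assoc, pow_add]; exact Ideal.mul_mem_mul ha (hθ b hb)
      convert add_mem h1 h2 using 1
      simp only [Derivation.leibniz, smul_eq_mul, add_mul, Finset.sum_add_distrib, mul_sub,
        Finset.mul_sum]
      push_cast
      simp only [mul_assoc]
      ring
    · convert add_mem ha hb using 1
      simp only [map_add, add_mul, Finset.sum_add_distrib]
      ring

end Conormal

/-! ### Orders along a smooth center in characteristic zero -/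

section CharZero

variable {k A : Type*} [Field k] [CharZero k] [CommRing A] [Algebra k A]

/-- In characteristic zero the nilradical is stable under derivations. -/
theorem Derivation.isNilpotent_apply (E : Derivation k A A) {a : A} (ha : IsNilpotent a) :
    IsNilpotent (E a) := by
  obtain ⟨n, hn⟩ := ha
  -- `a ^ (n - j) * (E a) ^ (2 j)` vanishes for every `j ≤ n`
  have key : ∀ j m, m + j = n → a ^ m * E a ^ (2 * j) = 0 := by
    intro j
    induction j with
    | zero => intro m hm; simpa [show m = n by omega] using hn
    | succ j ih =>
      intro m hm
      have h0 := ih (m + 1) (by omega)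
      have h1 := congrArg E h0
      rw [E.leibniz, E.leibniz_pow, E.leibniz_pow, map_zero] at h1
      simp only [smul_eq_mul, nsmul_eq_mul, Nat.add_sub_cancel] at h1
      have h2 : ((m + 1 : ℕ) : A) * (a ^ m * E a ^ (2 * (j + 1))) = 0 := by
        have h3 := congrArg (E a * ·) h1
        simp only [mul_zero] at h3
        rcases j with _ | j
        · simp at h3 ⊢
          linear_combination h3
        · have h4 : E a * E a ^ (2 * (j + 1) - 1) = E a ^ (2 * (j + 1)) := by
            rw [← pow_succ']; congr 1
          linear_combination h3 - (((2 * (j + 1) : ℕ) : A) * E (E a)) * h0 -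
            a ^ (m + 1) * ((2 * (j + 1) : ℕ) : A) * E (E a) * h4
      simpa using Ideal.mem_of_natCast_succ_mul_mem k (I := (⊥ : Ideal A)) (by simpa using h2)
  exact ⟨2 * n, by simpa using key n 0 (by omega)⟩

/-- A smooth algebra over a field of characteristic zero is reduced: the nilradical is stable
under derivations, so Euler's identity along a maximal ideal shows that it is contained in all
powers of that maximal ideal. -/
theorem isReduced_of_formallySmooth [Algebra.FiniteType k A] [Algebra.FormallySmooth k A] :
    IsReduced A := by
  have hnoeth := Algebra.FiniteType.isNoetherianRing k A
  suffices H : ∀ (m : Ideal A) [m.IsMaximal] (n : ℕ) (a : A), IsNilpotent a → a ∈ m ^ n by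
    -- Krull's intersection theorem at a maximal ideal containing the annihilator of `a`
    refine ⟨fun a ha => ?_⟩
    by_contra hne
    obtain ⟨m, hm, hle⟩ := Ideal.exists_le_maximal ((⊥ : Ideal A).colon {a}) (by
      rw [Ne, Ideal.eq_top_iff_one, Submodule.mem_colon_singleton]
      simpa using hne)
    have : a ∈ (⨅ i : ℕ, m ^ i • ⊤ : Submodule A A) := by
      simpa using fun i => H m i a ha
    obtain ⟨r, hr⟩ := (m.mem_iInf_smul_pow_eq_bot_iff a).mp this
    have h1 : 1 - (r : A) ∈ m := hle (by
      rw [Submodule.mem_colon_singleton]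
      simpa [sub_mul, sub_eq_zero] using hr.symm)
    exact hm.ne_top ((Ideal.eq_top_iff_one m).mpr (by simpa using add_mem h1 r.2))
  intro m hm n
  let : Field (A ⧸ m) := Ideal.Quotient.field m
  have hsmooth : Algebra.FormallySmooth k (A ⧸ m) := inferInstance
  obtain ⟨s, hs⟩ := (isNoetherianRing_iff_ideal_fg A).mp hnoeth m
  have hs' : Ideal.span (Set.range (Subtype.val : s → A)) = m := by simpa using hs
  obtain ⟨θ, hθ⟩ := exists_derivation_sum_sub_mem_sq (k := k) m (Subtype.val : s → A) hs'
  have hsm : ∀ i : s, (i : A) ∈ m := fun i => by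
    rw [← hs']; exact Ideal.subset_span ⟨i, rfl⟩
  induction n with
  | zero => intro a _; simp
  | succ n ih =>
    intro a ha
    rcases n with _ | n
    · simpa using nilradical_le_prime m (mem_nilradical.mpr ha)
    have h1 := sum_derivation_mul_sub_mem_pow hsm hθ (ih a ha)
    have h2 : ∑ i, θ i a * (i : A) ∈ m ^ (n + 1 + 1) := Submodule.sum_mem _ fun i _ => by
      rw [pow_succ]
      exact Ideal.mul_mem_mul (ih _ ((θ i).isNilpotent_apply ha)) (hsm i)
    have h3 := sub_mem h2 h1
    rw [sub_sub_cancel] at h3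
    exact Ideal.mem_of_natCast_succ_mul_mem k h3

/-- The preimage in `A` of the `n`-th power of the maximal ideal of the localization at `p`. -/
def symbolicPow (p : Ideal A) [p.IsPrime] (n : ℕ) : Ideal A where
  carrier := {h | ∃ s ∉ p, s * h ∈ p ^ n}
  add_mem' := by
    rintro a b ⟨s, hs, hsa⟩ ⟨t, ht, htb⟩
    refine ⟨s * t, fun h => (Ideal.IsPrime.mem_or_mem ‹_› h).elim hs ht, ?_⟩
    rw [show s * t * (a + b) = t * (s * a) + s * (t * b) by ring]
    exact add_mem (Ideal.mul_mem_left _ _ hsa) (Ideal.mul_mem_left _ _ htb)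
  zero_mem' := ⟨1, fun h => Ideal.IsPrime.ne_top ‹_› ((Ideal.eq_top_iff_one p).mpr h), by simp⟩
  smul_mem' := by
    rintro c a ⟨s, hs, hsa⟩
    refine ⟨s, hs, ?_⟩
    rw [smul_eq_mul, mul_left_comm]
    exact Ideal.mul_mem_left _ _ hsa

omit [CharZero k] in
theorem derivationClosed_symbolicPow (p : Ideal A) [hp : p.IsPrime] :
    DerivationClosed k (symbolicPow p) := by
  rintro E n h ⟨s, hs, hsh⟩
  refine ⟨s * s, fun h => (hp.mem_or_mem h).elim hs hs, ?_⟩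
  have h1 := E.apply_mem_pow p hsh
  rw [E.leibniz, smul_eq_mul, smul_eq_mul] at h1
  have h2 : E s * (s * h) ∈ p ^ n := Ideal.mul_mem_left _ _ (Ideal.pow_le_pow_right n.le_succ hsh)
  convert sub_mem (Ideal.mul_mem_left _ s h1) h2 using 1
  ring

/-- Along a smooth center with ideal `J`, an element that has order at least `n` at all points of
the center lies in `J ^ n`. For `n = 1` this holds because `A ⧸ J` is reduced; for `n + 1` the
element lies in `J ^ n` and its derivatives have order at least `n`, so Euler's identity along `J`
applies. -/
theorem mem_pow_of_forall_mem_symbolicPow [Algebra.FiniteType k A] [Algebra.FormallySmooth k A]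
    {J : Ideal A} [Algebra.FormallySmooth k (A ⧸ J)] {n : ℕ} {h : A}
    (hh : ∀ (p : Ideal A) [p.IsPrime], J ≤ p → h ∈ symbolicPow p n) : h ∈ J ^ n := by
  have := Algebra.FiniteType.isNoetherianRing k A
  obtain ⟨s, hs⟩ := (isNoetherianRing_iff_ideal_fg A).mp this J
  have hs' : Ideal.span (Set.range (Subtype.val : s → A)) = J := by simpa using hs
  obtain ⟨θ, hθ⟩ := exists_derivation_sum_sub_mem_sq (k := k) J (Subtype.val : s → A) hs'
  have hsm : ∀ i : s, (i : A) ∈ J := fun i => by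
    rw [← hs']; exact Ideal.subset_span ⟨i, rfl⟩
  have hanti : ∀ (p : Ideal A) [p.IsPrime] (n : ℕ), symbolicPow p (n + 1) ≤ symbolicPow p n := by
    rintro p _ n a ⟨t, ht, hta⟩
    exact ⟨t, ht, Ideal.pow_le_pow_right n.le_succ hta⟩
  induction n generalizing h with
  | zero => simp
  | succ n ih =>
    rcases n with _ | n
    · have : IsReduced (A ⧸ J) := isReduced_of_formallySmooth (k := k)
      rw [zero_add, pow_one, ← ((Ideal.isRadical_iff_quotient_reduced J).mpr this).radical,
        Ideal.radical_eq_sInf, Submodule.mem_sInf]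
      rintro p ⟨hJp, hp⟩
      obtain ⟨t, ht, hth⟩ := hh p hJp
      exact (hp.mem_or_mem (by simpa using hth)).resolve_left ht
    have h0 := ih (h := h) fun p _ hp => hanti p _ (hh p hp)
    have h1 := sum_derivation_mul_sub_mem_pow hsm hθ h0
    have h2 : ∑ i, θ i h * (i : A) ∈ J ^ (n + 1 + 1) := Submodule.sum_mem _ fun i _ => by
      rw [pow_succ]
      exact Ideal.mul_mem_mul
        (ih fun p _ hp => derivationClosed_symbolicPow p (θ i) _ _ (hh p hp)) (hsm i)
    have h3 := sub_mem h2 h1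
    rw [sub_sub_cancel] at h3
    exact Ideal.mem_of_natCast_succ_mul_mem k h3

end CharZero

/-! ### Localization and standard open covers -/

section Localization

variable {k A B : Type*} [CommRing k] [CommRing A] [Algebra k A] [CommRing B] [Algebra k B]
  [Algebra A B] [IsScalarTower k A B]

/-- A derivation from `A` to a localization `B` of `A` extends to `B`. -/
theorem exists_derivation_extension (M : Submonoid A) [IsLocalization M B]
    (E : Derivation k A B) : ∃ E' : Derivation k B B, ∀ a, E' (algebraMap A B a) = E a := by
  let φ : Ω[B⁄k] →ₗ[A] B := IsLocalizedModule.lift M (KaehlerDifferential.map k k A B)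
    E.liftKaehlerDifferential fun x => by
      have := (IsLocalization.map_units B x).map (Algebra.lmul A B)
      convert this using 1
      ext b
      simp [Algebra.smul_def]
  refine ⟨(φ.extendScalarsOfIsLocalization M B).compDer (D k B), fun a => ?_⟩
  have h : φ (KaehlerDifferential.map k k A B (D k A a)) = E.liftKaehlerDifferential (D k A a) :=
    IsLocalizedModule.lift_apply M (KaehlerDifferential.map k k A B) _ _ _
  rw [KaehlerDifferential.map_D, Derivation.liftKaehlerDifferential_comp_D] at h
  exact h

theorem IsLocalization.exists_pow_mul_mem {I : Ideal A} (g : A) [IsLocalization.Away g B] {a : A}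
    (h : algebraMap A B a ∈ I.map (algebraMap A B)) : ∃ n : ℕ, g ^ n * a ∈ I := by
  rw [IsLocalization.algebraMap_mem_map_algebraMap_iff (Submonoid.powers g)] at h
  obtain ⟨_, ⟨n, rfl⟩, hn⟩ := h
  exact ⟨n, hn⟩

theorem HasProjectiveKaehler.of_isLocalizationAway (h : HasProjectiveKaehler k A) (g : A)
    [IsLocalization.Away g B] : HasProjectiveKaehler k B where
  finiteType :=
    h.finiteType.trans (IsLocalization.finiteType_of_monoid_fg (Submonoid.powers g) B)
  projective :=
    have := h.projective
    Module.projective_of_isLocalizedModule (Submonoid.powers g) (KaehlerDifferential.map k k A B)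

end Localization

section Cover

variable {A : Type*} [CommRing A] {s : Set A} (hs : Ideal.span s = ⊤) (B : s → Type*)
  [∀ r, CommRing (B r)] [∀ r, Algebra A (B r)] [∀ r : s, IsLocalization.Away r.1 (B r)]

include hs in
theorem Ideal.mem_of_forall_algebraMap_mem {I : Ideal A} {a : A}
    (h : ∀ r, algebraMap A (B r) a ∈ I.map (algebraMap A (B r))) : a ∈ I :=
  Submodule.mem_of_span_eq_top_of_smul_pow_mem I s hs a fun r =>
    IsLocalization.exists_pow_mul_mem (B := B r) r.1 (h r)

include hs in
/-- Projectivity of the differentials is local: for finitely presented modules it amounts to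
flatness. -/
theorem HasProjectiveKaehler.of_span_eq_top {k : Type*} [Field k] [Algebra k A]
    [∀ r, Algebra k (B r)] [∀ r, IsScalarTower k A (B r)]
    (h : ∀ r, HasProjectiveKaehler k (B r)) : HasProjectiveKaehler k A := by
  have hft : Algebra.FiniteType k A := Algebra.FiniteType.of_span_eq_top_target s hs
    fun x hx => by
      have := (h ⟨x, hx⟩).finiteType
      let e : B ⟨x, hx⟩ ≃ₐ[A] Localization.Away x :=
        have : IsLocalization (Submonoid.powers x) (B ⟨x, hx⟩) :=
          inferInstanceAs (IsLocalization.Away (⟨x, hx⟩ : s).1 (B ⟨x, hx⟩))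
        IsLocalization.algEquiv (Submonoid.powers x) _ _
      exact Algebra.FiniteType.equiv this (e.restrictScalars k)
  have hnoeth := Algebra.FiniteType.isNoetherianRing k A
  have hflat : Module.Flat A Ω[A⁄k] := by
    refine Module.flat_of_isLocalized_span A Ω[A⁄k] s hs (fun r => Ω[B r⁄k])
      (fun r => KaehlerDifferential.map k k A (B r)) fun r => ?_
    have := (h r).projective
    have : Module.Flat A (B r) := IsLocalization.flat _ (Submonoid.powers r.1)
    exact Module.Flat.trans A (B r) _
  have : Module.FinitePresentation A Ω[A⁄k] := Module.finitePresentation_of_finite A _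
  exact ⟨hft, Module.Flat.projective_of_finitePresentation⟩

end Cover

/-! ### Differential families of ideals -/

section DiffFamily

variable {k A B : Type*} [CommRing k] [CommRing A] [Algebra k A] [CommRing B]
  [Algebra k B] [Algebra A B] [IsScalarTower k A B]

/-- If `Ω[A⁄k]` has a dual basis, the extension of a decreasing family of ideals closed under
derivations to any `A`-algebra is again closed under derivations. -/
theorem DerivationClosed.map (hA : HasProjectiveKaehler k A) {I : ℕ → Ideal A}
    (hI : DerivationClosed k I) (hanti : ∀ n, I (n + 1) ≤ I n) :
    DerivationClosed k fun n => (I n).map (algebraMap A B) := by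
  obtain ⟨m, x, δ, hx⟩ := hA.exists_dualBasis
  intro E n h hh
  refine Submodule.span_induction (p := fun h _ => E h ∈ (I n).map (algebraMap A B))
    ?_ (by simp) (fun a b _ _ ha hb => by rw [map_add]; exact add_mem ha hb) ?_ hh
  · rintro _ ⟨a, ha, rfl⟩
    have := hx.apply_eq_sum (E.compAlgebraMap A) a
    simp only [Derivation.compAlgebraMap_apply] at this
    rw [this]
    refine Submodule.sum_mem _ fun i _ => ?_
    rw [Algebra.smul_def]
    exact Ideal.mul_mem_right _ _ (Ideal.mem_map_of_mem _ (hI (δ i) n a ha))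
  · intro c b hb hEb
    rw [smul_eq_mul, E.leibniz]
    refine add_mem (Ideal.mul_mem_left _ _ hEb) (Ideal.mul_mem_right _ _ ?_)
    exact Ideal.map_mono (hanti n) hb

theorem DerivationClosed.of_span_eq_top {s : Set A} (hs : Ideal.span s = ⊤) (B : s → Type*)
    [∀ r, CommRing (B r)] [∀ r, Algebra A (B r)] [∀ r : s, IsLocalization.Away r.1 (B r)]
    [∀ r, Algebra k (B r)] [∀ r, IsScalarTower k A (B r)] {I : ℕ → Ideal A}
    (h : ∀ r, DerivationClosed k fun n => (I n).map (algebraMap A (B r))) :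
    DerivationClosed k I := by
  intro E n a ha
  refine Ideal.mem_of_forall_algebraMap_mem hs B fun r => ?_
  obtain ⟨E', hE'⟩ := exists_derivation_extension (Submonoid.powers r.1)
    ((Algebra.linearMap A (B r)).compDer E)
  have := h r E' n _ (Ideal.mem_map_of_mem _ ha)
  rwa [hE'] at this

variable (k) in
/-- A family of ideals `K n` such that `⨁ K n Wⁿ` is a graded subalgebra of `A[W]` which is closed
under decreasing the degree, and in which a derivation decreases the degree by at most one. -/
structure IsDiffFamily (K : ℕ → Ideal A) : Prop where
  zero : K 0 = ⊤
  mul_le : ∀ m n, K m * K n ≤ K (m + n)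
  succ_le : ∀ n, K (n + 1) ≤ K n
  derivationClosed : DerivationClosed k K

variable (k) in
/-- The smallest differential family of ideals containing a given family of ideals. -/
def diffHull (I : ℕ → Ideal A) (n : ℕ) : Ideal A :=
  sInf {J | ∃ K : ℕ → Ideal A, IsDiffFamily k K ∧ (∀ m, I m ≤ K m) ∧ K n = J}

theorem le_diffHull (I : ℕ → Ideal A) (n : ℕ) : I n ≤ diffHull k I n :=
  le_sInf <| by rintro _ ⟨K, _, h, rfl⟩; exact h n

theorem diffHull_le {I K : ℕ → Ideal A} (hK : IsDiffFamily k K) (h : ∀ m, I m ≤ K m) (n : ℕ) :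
    diffHull k I n ≤ K n := sInf_le ⟨K, hK, h, rfl⟩

theorem mem_diffHull {I : ℕ → Ideal A} {n : ℕ} {a : A} : a ∈ diffHull k I n ↔
    ∀ K : ℕ → Ideal A, IsDiffFamily k K → (∀ m, I m ≤ K m) → a ∈ K n := by
  simp only [diffHull, Submodule.mem_sInf]
  exact ⟨fun h K hK hI => h _ ⟨K, hK, hI, rfl⟩, by rintro h _ ⟨K, hK, hI, rfl⟩; exact h K hK hI⟩

theorem isDiffFamily_diffHull (I : ℕ → Ideal A) : IsDiffFamily k (diffHull k I) where
  zero := by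
    rw [Ideal.eq_top_iff_one, mem_diffHull]
    intro K hK _
    simp [hK.zero]
  mul_le m n := by
    rw [Ideal.mul_le]
    intro a ha b hb
    rw [mem_diffHull]
    exact fun K hK hI => hK.mul_le m n
      (Ideal.mul_mem_mul (mem_diffHull.mp ha K hK hI) (mem_diffHull.mp hb K hK hI))
  succ_le n a ha := mem_diffHull.mpr fun K hK hI => hK.succ_le n (mem_diffHull.mp ha K hK hI)
  derivationClosed E n a ha :=
    mem_diffHull.mpr fun K hK hI => hK.derivationClosed E n a (mem_diffHull.mp ha K hK hI)

theorem IsDiffFamily.map (hA : HasProjectiveKaehler k A) {K : ℕ → Ideal A}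
    (hK : IsDiffFamily k K) : IsDiffFamily k fun n => (K n).map (algebraMap A B) where
  zero := by rw [hK.zero, Ideal.map_top]
  mul_le m n := by rw [← Ideal.map_mul]; exact Ideal.map_mono (hK.mul_le m n)
  succ_le n := Ideal.map_mono (hK.succ_le n)
  derivationClosed := hK.derivationClosed.map hA hK.succ_le

/-- The formation of differential hulls commutes with localization: differential families can be
extended to a localization, and restricted since derivations extend to localizations. -/
theorem map_diffHull (hA : HasProjectiveKaehler k A) (M : Submonoid A) [IsLocalization M B]
    (I : ℕ → Ideal A) (n : ℕ) :
    (diffHull k I n).map (algebraMap A B) =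
      diffHull k (fun n => (I n).map (algebraMap A B)) n := by
  refine le_antisymm ?_ (diffHull_le ((isDiffFamily_diffHull I).map hA)
    (fun m => Ideal.map_mono (le_diffHull I m)) n)
  rw [Ideal.map_le_iff_le_comap]
  have hB := isDiffFamily_diffHull (k := k) fun n => (I n).map (algebraMap A B)
  refine diffHull_le (K := fun n => Ideal.comap (algebraMap A B)
    (diffHull k (fun n => (I n).map (algebraMap A B)) n)) ⟨?_, ?_, ?_, ?_⟩ (fun m => ?_) n
  · rw [hB.zero, Ideal.comap_top]
  · intro m n
    exact (Ideal.le_comap_mul _).trans (Ideal.comap_mono (hB.mul_le m n))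
  · exact fun n => Ideal.comap_mono (hB.succ_le n)
  · intro E n a ha
    obtain ⟨E', hE'⟩ := exists_derivation_extension M ((Algebra.linearMap A B).compDer E)
    have := hB.derivationClosed E' n _ ha
    rw [hE'] at this
    exact this
  · rw [← Ideal.map_le_iff_le_comap]
    exact le_diffHull (k := k) (fun n => (I n).map (algebraMap A B)) m

end DiffFamily

/-! ### Finite generation -/

section FiniteGeneration

variable {A : Type*} [CommRing A]

/-- `⨁ I n Wⁿ` is the subalgebra of `A[W]` generated by finitely many elements `f W ^ n` with
`n ≥ 1`. -/
def IsFGFamily (I : ℕ → Ideal A) : Prop :=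
  ∃ F : Finset (A × ℕ), (∀ p ∈ F, 1 ≤ p.2) ∧ ∀ q : A[X],
    q ∈ Algebra.adjoin A ((fun p : A × ℕ => monomial p.2 p.1) '' (F : Set _)) ↔
      ∀ n, q.coeff n ∈ I n

/-- The subalgebra of `A[W]` generated by elements `f Wⁿ`, `(f, n) ∈ F`. -/
def adjoinMonomials (F : Set (A × ℕ)) : Subalgebra A A[X] :=
  Algebra.adjoin A ((fun p : A × ℕ => monomial p.2 p.1) '' F)

/-- The ideal of coefficients in degree `n` of the subalgebra of `A[W]` generated by `F`. -/
def monomialIdeal (F : Set (A × ℕ)) (n : ℕ) : Ideal A :=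
  (Subalgebra.toSubmodule (adjoinMonomials F)).comap (monomial n)

theorem mem_monomialIdeal {F : Set (A × ℕ)} {n : ℕ} {a : A} :
    a ∈ monomialIdeal F n ↔ monomial n a ∈ adjoinMonomials F := Iff.rfl

theorem monomialIdeal_zero (F : Set (A × ℕ)) : monomialIdeal F 0 = ⊤ := by
  rw [Ideal.eq_top_iff_one, mem_monomialIdeal, monomial_zero_one]
  exact one_mem _

theorem mul_mem_monomialIdeal {F : Set (A × ℕ)} {m n : ℕ} {a b : A} (ha : a ∈ monomialIdeal F m)
    (hb : b ∈ monomialIdeal F n) : a * b ∈ monomialIdeal F (m + n) := by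
  rw [mem_monomialIdeal, ← monomial_mul_monomial]
  exact mul_mem ha hb

theorem subset_monomialIdeal {F : Set (A × ℕ)} {p : A × ℕ} (hp : p ∈ F) :
    p.1 ∈ monomialIdeal F p.2 := Algebra.subset_adjoin ⟨p, hp, rfl⟩

theorem coeff_mem_of_mem_adjoinMonomials {F : Set (A × ℕ)} {I : ℕ → Ideal A} (hI0 : I 0 = ⊤)
    (hI : ∀ m n, I m * I n ≤ I (m + n)) (hF : ∀ p ∈ F, p.1 ∈ I p.2) {q : A[X]}
    (hq : q ∈ adjoinMonomials F) (n : ℕ) : q.coeff n ∈ I n := by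
  induction hq using Algebra.adjoin_induction generalizing n with
  | mem q hq =>
    obtain ⟨p, hp, rfl⟩ := hq
    simp only [coeff_monomial]
    split_ifs with h
    · exact h ▸ hF p hp
    · exact zero_mem _
  | algebraMap r =>
    rw [← C_eq_algebraMap, coeff_C]
    split_ifs with h
    · simp [h, hI0]
    · exact zero_mem _
  | add x y _ _ hx hy => rw [coeff_add]; exact add_mem (hx n) (hy n)
  | mul x y _ _ hx hy =>
    rw [coeff_mul]
    refine Submodule.sum_mem _ fun p hp => ?_
    rw [← Finset.HasAntidiagonal.mem_antidiagonal.mp hp]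
    exact hI _ _ (Ideal.mul_mem_mul (hx _) (hy _))

theorem mem_adjoinMonomials_iff {F : Set (A × ℕ)} {q : A[X]} :
    q ∈ adjoinMonomials F ↔ ∀ n, q.coeff n ∈ monomialIdeal F n := by
  refine ⟨fun hq => coeff_mem_of_mem_adjoinMonomials (monomialIdeal_zero F)
    (fun m n => Ideal.mul_le.mpr fun a ha b hb => mul_mem_monomialIdeal ha hb)
    (fun p hp => subset_monomialIdeal hp) hq, fun h => ?_⟩
  rw [q.as_sum_support]
  exact Subalgebra.sum_mem _ fun n _ => h n

theorem isFGFamily_iff {I : ℕ → Ideal A} :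
    IsFGFamily I ↔ ∃ F : Finset (A × ℕ), (∀ p ∈ F, 1 ≤ p.2) ∧
      ∀ n, monomialIdeal (F : Set (A × ℕ)) n = I n := by
  refine exists_congr fun F => and_congr_right fun _ => ⟨fun h n => ?_, fun h q => ?_⟩
  · ext a
    rw [mem_monomialIdeal]
    refine (h _).trans ⟨fun h => by simpa using h n, fun h m => ?_⟩
    rw [coeff_monomial]
    split_ifs with hm
    · exact hm ▸ h
    · exact zero_mem _
  · refine mem_adjoinMonomials_iff.trans ?_
    simp only [h]

theorem monomialIdeal_le {F : Set (A × ℕ)} {I : ℕ → Ideal A} (hI0 : I 0 = ⊤)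
    (hI : ∀ m n, I m * I n ≤ I (m + n)) (hF : ∀ p ∈ F, p.1 ∈ I p.2) (n : ℕ) :
    monomialIdeal F n ≤ I n := fun a ha => by
  simpa using coeff_mem_of_mem_adjoinMonomials hI0 hI hF (mem_monomialIdeal.mp ha) n

/-- If decreasing the degree by one and applying the derivation `E` send the generators into the
subalgebra, they send all coefficients into the subalgebra. -/
theorem apply_mem_monomialIdeal {k : Type*} [CommRing k] [Algebra k A] {F : Set (A × ℕ)}
    (E : Derivation k A A)
    (hF : ∀ p ∈ F, ∀ m, p.2 = m + 1 → p.1 ∈ monomialIdeal F m ∧ E p.1 ∈ monomialIdeal F m)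
    {n : ℕ} {a : A} (ha : a ∈ monomialIdeal F (n + 1)) :
    a ∈ monomialIdeal F n ∧ E a ∈ monomialIdeal F n := by
  suffices H : ∀ q ∈ adjoinMonomials F, ∀ n, q.coeff (n + 1) ∈ monomialIdeal F n ∧
      E (q.coeff (n + 1)) ∈ monomialIdeal F n by
    simpa using H _ (mem_monomialIdeal.mp ha) n
  intro q hq
  induction hq using Algebra.adjoin_induction with
  | mem q hq =>
    obtain ⟨p, hp, rfl⟩ := hq
    intro n
    simp only [coeff_monomial]
    split_ifs with h
    · exact hF p hp n h
    · simp
  | algebraMap r => intro n; simp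
  | add x y _ _ hx hy =>
    intro n
    rw [coeff_add, map_add]
    exact ⟨add_mem (hx n).1 (hy n).1, add_mem (hx n).2 (hy n).2⟩
  | mul x y hxS hyS hx hy =>
    intro n
    have hx0 := mem_adjoinMonomials_iff.mp hxS
    have hy0 := mem_adjoinMonomials_iff.mp hyS
    have hl : ∀ {c d i j} (_ : c ∈ monomialIdeal F i) (_ : d ∈ monomialIdeal F j)
        (_ : i + j = n), c * d ∈ monomialIdeal F n := by
      rintro c d i j hc hd rfl
      exact mul_mem_monomialIdeal hc hd
    have htop : ∀ c, c ∈ monomialIdeal F 0 := fun c => by simp [monomialIdeal_zero]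
    rw [coeff_mul, map_sum]
    refine ⟨Submodule.sum_mem _ ?_, Submodule.sum_mem _ ?_⟩ <;> rintro ⟨i, j⟩ hij <;>
      rw [Finset.HasAntidiagonal.mem_antidiagonal] at hij <;> dsimp only at hij ⊢
    · rcases i with _ | i
      · obtain rfl : j = n + 1 := by omega
        exact hl (hx0 0) (hy n).1 (by omega)
      · exact hl (hx i).1 (hy0 j) (by omega)
    · rw [E.leibniz, smul_eq_mul, smul_eq_mul]
      refine add_mem ?_ ?_
      · rcases j with _ | j
        · exact hl ((show i = n + 1 by omega) ▸ hx n).1 (htop _) rfl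
        · exact hl (hx0 i) (hy j).2 (by omega)
      · rcases i with _ | i
        · exact hl ((show j = n + 1 by omega) ▸ hy n).1 (htop _) rfl
        · exact hl (hy0 j) (hx i).2 (by omega)

/-- Finite generation of the differential hull: if `⨁ I n Wⁿ` is generated by elements `f Wᴺ`, its
differential hull is generated by the elements `g Wᵐ`, `m ≥ 1`, where `g` is obtained from `f` by
applying at most `N - m` derivations from a dual basis. -/
theorem IsFGFamily.diffHull {k : Type*} [CommRing k] [Algebra k A]
    (hA : HasProjectiveKaehler k A) {I : ℕ → Ideal A} (hI : IsFGFamily I) :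
    IsFGFamily (diffHull k I) := by
  obtain ⟨F, hF1, hF⟩ := isFGFamily_iff.mp hI
  obtain ⟨d, x, δ, hx⟩ := hA.exists_dualBasis
  have hdiff := isDiffFamily_diffHull (k := k) I
  -- iterated derivatives; `G` consists of the claimed generators
  let ap : List (Fin d) → A → A := fun l a => l.foldr (fun i b => δ i b) a
  let G : Set (A × ℕ) := {p | ∃ q ∈ F, ∃ l : List (Fin d), l.length + p.2 ≤ q.2 ∧ 1 ≤ p.2 ∧
    p.1 = ap l q.1}
  have hGfin : G.Finite := by
    have h1 : (⋃ q ∈ F, (fun w : List (Fin d) × ℕ => (ap w.1 q.1, w.2)) ''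
        ({l : List (Fin d) | l.length ≤ q.2} ×ˢ {m | m ≤ q.2})).Finite :=
      F.finite_toSet.biUnion fun q _ =>
        ((List.finite_length_le _ _).prod (Set.finite_le_nat _)).image _
    refine h1.subset ?_
    rintro ⟨g, m⟩ ⟨q, hq, l, hl, hm, rfl⟩
    simp only [Set.mem_iUnion]
    dsimp only at hl
    exact ⟨q, hq, (l, m), ⟨show l.length ≤ q.2 by omega, show m ≤ q.2 by omega⟩, rfl⟩
  have hG : IsDiffFamily k (monomialIdeal G) := by
    have key : ∀ (i : Fin d) (n : ℕ) (a : A), a ∈ monomialIdeal G (n + 1) →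
        a ∈ monomialIdeal G n ∧ δ i a ∈ monomialIdeal G n := by
      intro i n a ha
      refine apply_mem_monomialIdeal (δ i) ?_ ha
      rintro ⟨g, m'⟩ ⟨q, hq, l, hl, hm, rfl⟩ m rfl
      rcases m with _ | m
      · simp [monomialIdeal_zero]
      · dsimp only at hl
        exact ⟨subset_monomialIdeal (p := (ap l q.1, m + 1))
            ⟨q, hq, l, by dsimp only; omega, by simp, rfl⟩,
          subset_monomialIdeal (p := (ap (i :: l) q.1, m + 1))
            ⟨q, hq, i :: l, by simp; omega, by simp, rfl⟩⟩
    refine ⟨monomialIdeal_zero G,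
      fun m n => Ideal.mul_le.mpr fun a ha b hb => mul_mem_monomialIdeal ha hb, ?_, ?_⟩
    · intro n a ha
      refine (apply_mem_monomialIdeal (0 : Derivation k A A) ?_ ha).1
      rintro ⟨g, m'⟩ ⟨q, hq, l, hl, hm, rfl⟩ m rfl
      refine ⟨?_, by simp⟩
      rcases m with _ | m
      · simp [monomialIdeal_zero]
      · dsimp only at hl
        exact subset_monomialIdeal (p := (ap l q.1, m + 1))
            ⟨q, hq, l, by dsimp only; omega, by simp, rfl⟩
    · intro E n a ha
      rw [hx.apply_eq_sum E a]
      exact Submodule.sum_mem _ fun i _ => Ideal.mul_mem_right _ _ (key i n a ha).2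
  refine isFGFamily_iff.mpr ⟨hGfin.toFinset, ?_, fun n => le_antisymm ?_ ?_⟩
  · rintro ⟨g, m⟩ h
    obtain ⟨q, hq, l, hl, hm, -⟩ := hGfin.mem_toFinset.mp h
    exact hm
  · rw [hGfin.coe_toFinset]
    refine monomialIdeal_le hdiff.zero hdiff.mul_le ?_ n
    rintro ⟨g, m⟩ ⟨q, hq, l, hl, hm, rfl⟩
    have hanti := antitone_nat_of_succ_le hdiff.succ_le
    have h0 : q.1 ∈ _root_.diffHull k I q.2 :=
      le_diffHull I _ (hF q.2 ▸ subset_monomialIdeal (F := (F : Set (A × ℕ))) hq)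
    have : ∀ (l : List (Fin d)) (m : ℕ), l.length + m ≤ q.2 →
        ap l q.1 ∈ _root_.diffHull k I m := by
      intro l
      induction l with
      | nil => intro m hm; exact hanti (by simpa using hm) h0
      | cons i l ih =>
        intro m hm
        exact hdiff.derivationClosed (δ i) m _ (ih (m + 1) (by simp at hm; omega))
    exact this l m hl
  · rw [hGfin.coe_toFinset]
    refine diffHull_le hG (fun m => ?_) n
    rw [← hF m]
    refine monomialIdeal_le hG.zero hG.mul_le (fun q hq => ?_) m
    exact subset_monomialIdeal (F := G) (p := q) ⟨q, hq, [], by simp, hF1 q hq, rfl⟩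

theorem map_mem_monomialIdeal_image {B : Type*} [CommRing B] [Algebra A B] {F : Set (A × ℕ)}
    {n : ℕ} {a : A} (ha : a ∈ monomialIdeal F n) : algebraMap A B a ∈
      monomialIdeal ((fun p : A × ℕ => (algebraMap A B p.1, p.2)) '' F) n :=
  monomialIdeal_le (I := fun n => Ideal.comap (algebraMap A B)
    (monomialIdeal ((fun p : A × ℕ => (algebraMap A B p.1, p.2)) '' F) n))
    (by rw [monomialIdeal_zero, Ideal.comap_top])
    (fun m n => Ideal.mul_le.mpr fun a ha b hb => by
      rw [Ideal.mem_comap, map_mul]; exact mul_mem_monomialIdeal ha hb)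
    (fun p hp => subset_monomialIdeal (p := (algebraMap A B p.1, p.2)) ⟨p, hp, rfl⟩) n ha

theorem IsFGFamily.map {B : Type*} [CommRing B] [Algebra A B] {I : ℕ → Ideal A}
    (hI0 : I 0 = ⊤) (hImul : ∀ m n, I m * I n ≤ I (m + n)) (hI : IsFGFamily I) :
    IsFGFamily fun n => (I n).map (algebraMap A B) := by
  classical
  obtain ⟨F, hF1, hF⟩ := isFGFamily_iff.mp hI
  refine isFGFamily_iff.mpr ⟨F.image fun p : A × ℕ => (algebraMap A B p.1, p.2), ?_,
    fun n => le_antisymm ?_ ?_⟩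
  · intro p hp
    obtain ⟨q, hq, rfl⟩ := Finset.mem_image.mp hp
    exact hF1 q hq
  · refine monomialIdeal_le (I := fun n => (I n).map (algebraMap A B))
      (by simp [hI0, Ideal.map_top])
      (fun m n => by rw [← Ideal.map_mul]; exact Ideal.map_mono (hImul m n)) ?_ n
    intro p hp
    obtain ⟨q, hq, rfl⟩ := Finset.mem_image.mp hp
    exact Ideal.mem_map_of_mem _ (hF q.2 ▸ subset_monomialIdeal (F := (F : Set (A × ℕ))) hq)
  · rw [Ideal.map_le_iff_le_comap, Finset.coe_image]
    intro a ha
    exact map_mem_monomialIdeal_image ((hF n).ge ha)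

/-- Finite generation of `⨁ I n Wⁿ` can be checked on a standard open cover. -/
theorem IsFGFamily.of_span_eq_top {s : Set A} (hsfin : s.Finite) (hs : Ideal.span s = ⊤)
    (B : s → Type*) [∀ r, CommRing (B r)] [∀ r, Algebra A (B r)]
    [∀ r : s, IsLocalization.Away r.1 (B r)] {I : ℕ → Ideal A} (hI0 : I 0 = ⊤)
    (hImul : ∀ m n, I m * I n ≤ I (m + n))
    (h : ∀ r, IsFGFamily fun n => (I n).map (algebraMap A (B r))) : IsFGFamily I := by
  classical
  have : Finite s := hsfin
  have := Fintype.ofFinite s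
  simp only [isFGFamily_iff] at h
  choose F hF1 hF using h
  -- the generators on the members of the cover, multiplied by denominators
  have hnum : ∀ (r : s) (p : B r × ℕ), ∃ a : A, p ∈ F r →
      a ∈ I p.2 ∧ ∃ N : ℕ, algebraMap A (B r) a = algebraMap A (B r) r.1 ^ N * p.1 := by
    intro r p
    by_cases hp : p ∈ F r
    · have : p.1 ∈ (I p.2).map (algebraMap A (B r)) :=
        (hF r p.2).le (subset_monomialIdeal (F := (F r : Set (B r × ℕ))) hp)
      obtain ⟨⟨⟨a, ha⟩, ⟨_, N, rfl⟩⟩, hN⟩ :=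
        (IsLocalization.mem_map_algebraMap_iff (Submonoid.powers r.1) (B r)).mp this
      refine ⟨a, fun _ => ⟨ha, N, ?_⟩⟩
      rw [← hN, mul_comm, map_pow]
    · exact ⟨0, fun h => absurd h hp⟩
  choose num hnum using hnum
  let G : Finset (A × ℕ) := Finset.univ.biUnion fun r => (F r).image fun p => (num r p, p.2)
  have hG : ∀ r, ∀ p ∈ F r, (num r p, p.2) ∈ G := fun r p hp =>
    Finset.mem_biUnion.mpr ⟨r, Finset.mem_univ _, Finset.mem_image_of_mem _ hp⟩
  refine isFGFamily_iff.mpr ⟨G, ?_, fun n => le_antisymm ?_ ?_⟩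
  · intro p hp
    obtain ⟨r, -, hr⟩ := Finset.mem_biUnion.mp hp
    obtain ⟨q, hq, rfl⟩ := Finset.mem_image.mp hr
    exact hF1 r q hq
  · refine monomialIdeal_le hI0 hImul ?_ n
    intro p hp
    obtain ⟨r, -, hr⟩ := Finset.mem_biUnion.mp hp
    obtain ⟨q, hq, rfl⟩ := Finset.mem_image.mp hr
    exact (hnum r q hq).1
  · intro a ha
    refine Ideal.mem_of_forall_algebraMap_mem hs B fun r => ?_
    have h1 : algebraMap A (B r) a ∈ monomialIdeal (F r : Set (B r × ℕ)) n :=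
      (hF r n).ge (Ideal.mem_map_of_mem _ ha)
    refine monomialIdeal_le (I := fun n => (monomialIdeal (G : Set (A × ℕ)) n).map
      (algebraMap A (B r))) (by rw [monomialIdeal_zero, Ideal.map_top]) ?_ ?_ n h1
    · intro m n
      rw [← Ideal.map_mul]
      exact Ideal.map_mono (Ideal.mul_le.mpr fun a ha b hb => mul_mem_monomialIdeal ha hb)
    · intro p hp
      obtain ⟨-, N, hN⟩ := hnum r p hp
      have hu : IsUnit (algebraMap A (B r) r.1 ^ N) :=
        (IsLocalization.Away.algebraMap_isUnit r.1).pow N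
      rw [← Ideal.unit_mul_mem_iff_mem _ hu, ← hN]
      exact Ideal.mem_map_of_mem _ (subset_monomialIdeal (F := (G : Set (A × ℕ))) (hG r p hp))

end FiniteGeneration

/-! ### The algebras `A[J / a]` -/

theorem Derivation.sum_apply {k A M ι : Type*} [CommRing k] [CommRing A] [Algebra k A]
    [AddCommGroup M] [Module A M] [Module k M] (s : Finset ι)
    (E : ι → Derivation k A M) (a : A) : (∑ i ∈ s, E i) a = ∑ i ∈ s, E i a := by
  classical
  induction s using Finset.induction_on with
  | empty => simp
  | insert i s hi ih => rw [Finset.sum_insert hi, Finset.sum_insert hi, Derivation.add_apply, ih]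

/-- The `A`-algebra `B` is the affine chart of the blow-up of `Spec A` along `J` on which the ideal
`J B` is generated by `a ∈ J`; i.e. `B` is `A[J / a]`. This is expressed by the properties that `a`
is regular on `B` and generates `J B`, that all elements of `B` are of the form `p / aⁿ` with
`p ∈ Jⁿ`, and that the kernel of `A → B` consists of `a`-power torsion. -/
structure IsBlowupChart {A : Type*} [CommRing A] (J : Ideal A) (a : A) (B : Type*) [CommRing B]
    [Algebra A B] : Prop where
  mem : a ∈ J
  regular : ∀ z z' : B, algebraMap A B a * z = algebraMap A B a * z' → z = z'
  map_eq : J.map (algebraMap A B) = Ideal.span {algebraMap A B a}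
  exists_eq : ∀ z : B, ∃ n : ℕ, ∃ p ∈ J ^ n, algebraMap A B a ^ n * z = algebraMap A B p
  exists_pow_mul_eq_zero : ∀ p : A, algebraMap A B p = 0 → ∃ n : ℕ, a ^ n * p = 0

namespace IsBlowupChart

variable {k A B : Type*} [CommRing k] [CommRing A] [Algebra k A] [CommRing B]
  [Algebra k B] [Algebra A B] [IsScalarTower k A B] {J : Ideal A} {a : A}

theorem regular_pow (h : IsBlowupChart J a B) (n : ℕ) {z z' : B}
    (hz : algebraMap A B a ^ n * z = algebraMap A B a ^ n * z') : z = z' := by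
  induction n with
  | zero => simpa using hz
  | succ n ih => exact ih (h.regular _ _ (by simpa only [pow_succ', mul_assoc] using hz))

theorem exists_mul_eq (h : IsBlowupChart J a B) {x : A} (hx : x ∈ J) :
    ∃ y : B, algebraMap A B a * y = algebraMap A B x := by
  have := h.map_eq ▸ Ideal.mem_map_of_mem (algebraMap A B) hx
  obtain ⟨y, hy⟩ := Ideal.mem_span_singleton'.mp this
  exact ⟨y, by rw [← hy, mul_comm]⟩

theorem map_pow_eq (h : IsBlowupChart J a B) (n : ℕ) :
    (J ^ n).map (algebraMap A B) = Ideal.span {algebraMap A B a ^ n} := by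
  rw [Ideal.map_pow, h.map_eq, Ideal.span_singleton_pow]

theorem exists_pow_mul_eq (h : IsBlowupChart J a B) {x : A} {n : ℕ} (hx : x ∈ J ^ n) :
    ∃ y : B, algebraMap A B a ^ n * y = algebraMap A B x := by
  have := h.map_pow_eq n ▸ Ideal.mem_map_of_mem (algebraMap A B) hx
  obtain ⟨y, hy⟩ := Ideal.mem_span_singleton'.mp this
  exact ⟨y, by rw [← hy, mul_comm]⟩

/-- The charts are generated by the fractions `f i / a`, for any generators `f i` of `J`. -/
theorem adjoin_eq_top (h : IsBlowupChart J a B) {ι : Type*} [Fintype ι] {f : ι → A}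
    (hf : Ideal.span (Set.range f) = J) {y : ι → B}
    (hy : ∀ i, algebraMap A B a * y i = algebraMap A B (f i)) :
    Algebra.adjoin A (Set.range y) = ⊤ := by
  -- `p / aⁿ` is a polynomial in the `f i / a` for `p ∈ Jⁿ`, by induction on `n`
  have key : ∀ n, ∀ p ∈ J ^ n, ∃ w ∈ Algebra.adjoin A (Set.range y),
      algebraMap A B p = algebraMap A B a ^ n * w := by
    intro n
    induction n with
    | zero => exact fun p _ => ⟨algebraMap A B p, Subalgebra.algebraMap_mem _ _, by simp⟩
    | succ n ih =>
      intro p hp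
      rw [pow_succ] at hp
      refine Submodule.mul_induction_on hp (fun p hp q hq => ?_) ?_
      · obtain ⟨w, hw, hpw⟩ := ih p hp
        have hq' : q ∈ Submodule.span A (Set.range f) := hf.ge hq
        obtain ⟨c, rfl⟩ := (Submodule.mem_span_range_iff_exists_fun A).mp hq'
        refine ⟨w * ∑ i, algebraMap A B (c i) * y i, mul_mem hw (Subalgebra.sum_mem _ fun i _ =>
          mul_mem (Subalgebra.algebraMap_mem _ _) (Algebra.subset_adjoin ⟨i, rfl⟩)), ?_⟩
        rw [map_mul, hpw, map_sum, pow_succ]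
        have : ∑ i, algebraMap A B (c i • f i) =
            algebraMap A B a * ∑ i, algebraMap A B (c i) * y i := by
          rw [Finset.mul_sum]
          refine Finset.sum_congr rfl fun i _ => ?_
          rw [smul_eq_mul, map_mul, ← hy]
          ring
        rw [this]
        ring
      · rintro p q ⟨w, hw, hpw⟩ ⟨w', hw', hpw'⟩
        exact ⟨w + w', add_mem hw hw', by rw [map_add, hpw, hpw', mul_add]⟩
  rw [eq_top_iff]
  intro z _
  obtain ⟨n, p, hp, hz⟩ := h.exists_eq z
  obtain ⟨w, hw, hpw⟩ := key n p hp
  rwa [h.regular_pow n (hz.trans hpw)]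

/-- A chart embeds into its localization at `a`. -/
theorem injective_algebraMap (h : IsBlowupChart J a B) (L : Type*) [CommRing L] [Algebra B L]
    [IsLocalization.Away (algebraMap A B a) L] : Function.Injective (algebraMap B L) := by
  refine IsLocalization.injective L (M := Submonoid.powers (algebraMap A B a)) ?_
  rintro _ ⟨n, rfl⟩
  refine mem_nonZeroDivisors_iff_right.mpr fun z hz => h.regular_pow n ?_
  simpa [mul_comm] using hz

/-- The blow-up is an isomorphism away from the exceptional divisor. -/
theorem isLocalization_away (h : IsBlowupChart J a B) (L : Type*) [CommRing L] [Algebra B L]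
    [Algebra A L] [IsScalarTower A B L] [IsLocalization.Away (algebraMap A B a) L] :
    IsLocalization.Away a L := by
  have hinj := h.injective_algebraMap L
  have htu : IsUnit (algebraMap B L (algebraMap A B a)) := IsLocalization.Away.algebraMap_isUnit _
  have hLA : algebraMap A L = (algebraMap B L).comp (algebraMap A B) :=
    IsScalarTower.algebraMap_eq A B L
  refine ⟨⟨?_, ?_, ?_⟩⟩
  · rintro ⟨_, n, rfl⟩
    simp only [map_pow, hLA, RingHom.comp_apply]
    exact htu.pow n
  · intro z
    obtain ⟨⟨z, ⟨_, m, rfl⟩⟩, hz⟩ := IsLocalization.surj (Submonoid.powers (algebraMap A B a)) z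
    obtain ⟨n, p, -, hp⟩ := h.exists_eq z
    refine ⟨(p, ⟨a ^ (n + m), n + m, rfl⟩), ?_⟩
    simp only [hLA, RingHom.comp_apply, ← hp, map_mul, ← hz, map_pow]
    ring
  · intro x y hxy
    rw [hLA, RingHom.comp_apply, RingHom.comp_apply] at hxy
    obtain ⟨n, hn⟩ := h.exists_pow_mul_eq_zero (x - y)
      (by rw [map_sub, sub_eq_zero]; exact hinj hxy)
    exact ⟨⟨a ^ n, n, rfl⟩, by simpa [mul_sub, sub_eq_zero] using hn⟩

/-- If `J = A` then every chart is a localization of `A`. -/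
theorem isLocalization_away_of_eq_top (h : IsBlowupChart J a B) (hJ : J = ⊤) :
    IsLocalization.Away a B := by
  have hu : IsUnit (algebraMap A B a) := by
    rw [← Ideal.span_singleton_eq_top, ← h.map_eq, hJ, Ideal.map_top]
  have : IsLocalization.Away (algebraMap A B a) B :=
    IsLocalization.away_of_isUnit_of_bijective B hu Function.bijective_id
  exact h.isLocalization_away B

/-- A derivation `E : A → B` extends to the chart `B` as soon as
`E (x) - (x / a) E (a) ∈ a B` for all `x ∈ J`, that is, as soon as its extension to the
localization at `a` maps the fractions `x / a` into `B`. -/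
theorem exists_derivation_extension (h : IsBlowupChart J a B) (E : Derivation k A B)
    (hE : ∀ x ∈ J, algebraMap A B a * E x - algebraMap A B x * E a ∈
      Ideal.span {algebraMap A B a ^ 2}) :
    ∃ E' : Derivation k B B, ∀ x, E' (algebraMap A B x) = E x := by
  set t := algebraMap A B a with ht
  let L := Localization.Away t
  have hinj : Function.Injective (algebraMap B L) := h.injective_algebraMap L
  have htu : IsUnit (algebraMap B L t) := IsLocalization.Away.algebraMap_isUnit t
  have hLA : algebraMap A L = (algebraMap B L).comp (algebraMap A B) :=
    IsScalarTower.algebraMap_eq A B L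
  have := h.isLocalization_away L
  obtain ⟨E', hE'⟩ := _root_.exists_derivation_extension (Submonoid.powers a)
    ((Algebra.linearMap B L).restrictScalars A |>.compDer E)
  replace hE' : ∀ x, E' (algebraMap B L (algebraMap A B x)) = algebraMap B L (E x) := by
    intro x
    have := hE' x
    rw [hLA] at this
    exact this
  -- the numerator of `E (p / aⁿ)`, up to a power of `a`
  have hpow : ∀ n : ℕ, ∀ p ∈ J ^ n, t * E p - n * algebraMap A B p * E a ∈
      Ideal.span {t ^ (n + 1)} := by
    intro n
    induction n with
    | zero => intro p _; simpa using Ideal.mul_mem_right _ _ (Ideal.mem_span_singleton_self t)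
    | succ n ih =>
      intro p hp
      rw [pow_succ] at hp
      refine Submodule.mul_induction_on hp (fun q hq x hx => ?_) fun q x hq hx => ?_
      · have h1 := Ideal.mul_mem_mul (ih q hq) (h.map_eq ▸ Ideal.mem_map_of_mem (algebraMap A B) hx)
        have h2 := Ideal.mul_mem_mul
          (h.map_pow_eq n ▸ Ideal.mem_map_of_mem (algebraMap A B) hq) (hE x hx)
        rw [Ideal.span_singleton_mul_span_singleton] at h1 h2
        rw [← ht, ← pow_succ] at h1
        rw [← ht, ← pow_add] at h2
        convert add_mem h1 h2 using 1
        rw [E.leibniz, map_mul, Algebra.smul_def, Algebra.smul_def]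
        push_cast
        ring
      · convert add_mem hq hx using 1
        rw [map_add, map_add]
        ring
  have hrange : ∀ z : B, ∃ w : B, algebraMap B L w = E' (algebraMap B L z) := by
    intro z
    obtain ⟨n, p, hp, hz⟩ := h.exists_eq z
    obtain ⟨w, hw⟩ := Ideal.mem_span_singleton'.mp (hpow n p hp)
    refine ⟨w, (htu.pow (n + 1)).mul_left_cancel ?_⟩
    rw [← map_pow, ← map_mul, mul_comm, hw, ← hz]
    have h1 := hE' p
    rw [← hz, map_mul, map_pow, E'.leibniz, E'.leibniz_pow, hE' a] at h1
    rcases n with _ | n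
    · simp only [map_sub, map_mul, ← h1, map_natCast, map_pow]
      simp
    · simp only [map_sub, map_mul, ← h1, map_natCast, map_pow, smul_eq_mul, nsmul_eq_mul,
        Nat.add_sub_cancel]
      ring
  choose G hG using hrange
  refine ⟨Derivation.mk' (LinearMap.mk ⟨G, fun z w => hinj ?_⟩ fun c z => hinj ?_)
    fun z w => hinj ?_, fun x => hinj ?_⟩
  · rw [hG, map_add, map_add, map_add, hG, hG]
  · have hs : ∀ z, algebraMap B L (c • z) = c • algebraMap B L z := fun z =>
      map_smul (IsScalarTower.toAlgHom k B L) c z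
    change algebraMap B L (G (c • z)) = algebraMap B L (c • G z)
    rw [hG, hs, hs, hG, E'.map_smul]
  · simp only [LinearMap.coe_mk, AddHom.coe_mk, smul_eq_mul, map_add, map_mul, hG, E'.leibniz]
  · exact (hG _).trans (hE' x)

/-- For a derivation `E` of `A`, the derivation `a E` extends to the chart. -/
theorem exists_derivation_mul (h : IsBlowupChart J a B) (E : Derivation k A A) :
    ∃ E' : Derivation k B B, ∀ x,
      E' (algebraMap A B x) = algebraMap A B a * algebraMap A B (E x) := by
  obtain ⟨E', hE'⟩ := h.exists_derivation_extension
    (algebraMap A B a • (Algebra.linearMap A B).compDer E) fun x hx => by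
      obtain ⟨y, hy⟩ := h.exists_mul_eq hx
      rw [Ideal.mem_span_singleton']
      refine ⟨algebraMap A B (E x) - y * algebraMap A B (E a), ?_⟩
      rw [← hy]
      simp only [Derivation.coe_smul, Pi.smul_apply, smul_eq_mul]
      change _ = algebraMap A B a * (algebraMap A B a * algebraMap A B (E x)) -
        algebraMap A B a * y * (algebraMap A B a * algebraMap A B (E a))
      ring
  exact ⟨E', hE'⟩

/-- The elements of `A` whose images in the chart lie in `aⁿ K n`, for a differential family `K`,
form a differential family: `D (aⁿ⁺¹ e) = (n + 1) aⁿ D (a) e + aⁿ (a D) (e)`. -/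
theorem isDiffFamily_comap (h : IsBlowupChart J a B) {K : ℕ → Ideal B} (hK : IsDiffFamily k K) :
    IsDiffFamily k fun n => (Ideal.span {algebraMap A B a ^ n} * K n).comap (algebraMap A B) where
  zero := by simp [hK.zero]
  mul_le m n := by
    refine (Ideal.le_comap_mul _).trans (Ideal.comap_mono ?_)
    rw [mul_mul_mul_comm, Ideal.span_singleton_mul_span_singleton, ← pow_add]
    exact Ideal.mul_mono_right (hK.mul_le m n)
  succ_le n := Ideal.comap_mono (Ideal.mul_mono
    ((Ideal.span_singleton_le_span_singleton).mpr (pow_dvd_pow _ n.le_succ)) (hK.succ_le n))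
  derivationClosed E n x hx := by
    obtain ⟨E', hE'⟩ := h.exists_derivation_mul E
    obtain ⟨e, he, hxe⟩ := Ideal.mem_span_singleton_mul.mp hx
    refine Ideal.mem_span_singleton_mul.mpr
      ⟨(n + 1) * algebraMap A B (E a) * e + E' e, add_mem (Ideal.mul_mem_left _ _ (hK.succ_le n he))
        (hK.derivationClosed E' n e he), h.regular _ _ ?_⟩
    rw [← hE' x, ← hxe, E'.leibniz, E'.leibniz_pow, hE' a]
    simp only [smul_eq_mul, nsmul_eq_mul, Nat.add_sub_cancel]
    push_cast
    ring

/-- Let `J` be generated by elements `f i` which are part of a coordinate system, i.e. for which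
there are derivations `θ i` of `A` with `θ i (f j) = δ i j`. Then the differentials of the charts of
the blow-up along `J` are projective: with `y j = f j / f i₀`, a dual basis is formed by the fields
`f i₀ θ i` for `i ≠ i₀` (with coordinate `y i`), the field `∑ i, y i θ i` (with coordinate `f i₀`),
and the fields of a dual basis for `A`, corrected so as to be tangent to all `f j = const`. -/
theorem hasProjectiveKaehler (hA : HasProjectiveKaehler k A) {ι : Type*} [Fintype ι]
    [DecidableEq ι] {f : ι → A} (hf : Ideal.span (Set.range f) = J) {θ : ι → Derivation k A A}
    (hθ : ∀ i j, θ i (f j) = if i = j then 1 else 0) {i₀ : ι} (h : IsBlowupChart J (f i₀) B) :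
    HasProjectiveKaehler k B := by
  obtain ⟨m, x, δ, hx⟩ := hA.exists_dualBasis
  set t := algebraMap A B (f i₀) with ht
  have hfJ : ∀ i, f i ∈ J := fun i => hf ▸ Ideal.subset_span ⟨i, rfl⟩
  choose y hy using fun i => h.exists_mul_eq (hfJ i)
  rw [← ht] at hy
  have hy0 : y i₀ = 1 := h.regular _ _ (by rw [← ht, hy, mul_one])
  have hadj := h.adjoin_eq_top hf hy
  refine ⟨hA.finiteType.trans ⟨⟨(Set.finite_range y).toFinset, by simpa using hadj⟩⟩, ?_⟩
  -- the extension criterion may be checked on the generators `f j`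
  have hext : ∀ E : Derivation k A B, (∀ j, t * E (f j) - algebraMap A B (f j) * E (f i₀) ∈
      Ideal.span {t ^ 2}) → ∃ E' : Derivation k B B, ∀ z, E' (algebraMap A B z) = E z := by
    intro E hE
    refine h.exists_derivation_extension E fun z hz => ?_
    rw [← ht]
    have hz' : z ∈ Submodule.span A (Set.range f) := hf.ge hz
    refine Submodule.span_induction (p := fun z _ => t * E z - algebraMap A B z * E (f i₀) ∈
      Ideal.span {t ^ 2}) ?_ (by simp) ?_ ?_ hz'
    · rintro _ ⟨j, rfl⟩
      exact hE j
    · intro z w _ _ hz hw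
      convert add_mem hz hw using 1
      rw [map_add, map_add]
      ring
    · intro c z hz hz'
      obtain ⟨w, hw⟩ := h.exists_mul_eq (hf.le hz)
      rw [← ht] at hw
      convert add_mem (Ideal.mul_mem_left _ (algebraMap A B c) hz')
        (Ideal.mul_mem_left _ (w * E c) (Ideal.mem_span_singleton_self (t ^ 2))) using 1
      rw [smul_eq_mul, E.leibniz, Algebra.smul_def, Algebra.smul_def, map_mul, ← hw]
      ring
  let ext (E : Derivation k A A) : Derivation k A B := (Algebra.linearMap A B).compDer E
  have hext_apply : ∀ (E : Derivation k A A) z, ext E z = algebraMap A B (E z) := fun _ _ => rfl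
  have hθB : ∀ i j, ext (θ i) (f j) = if i = j then 1 else 0 := by
    intro i j
    rw [hext_apply, hθ]
    split_ifs <;> simp
  -- the fields in the coordinates `Y i`, first as derivations on `A`
  let P : ι → Derivation k A B := fun i =>
    if i = i₀ then ∑ j, y j • ext (θ j) else t • ext (θ i)
  have hP : ∀ i, ∃ E' : Derivation k B B, ∀ z, E' (algebraMap A B z) = P i z := by
    intro i
    refine hext _ fun j => ?_
    by_cases hi : i = i₀
    · have : ∀ j, P i (f j) = y j := by
        intro j
        simp only [P, if_pos hi]
        rw [Derivation.sum_apply]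
        simp [hθB]
      rw [this, this, hy0, hy]
      simp
    · simp only [P, if_neg hi, Derivation.coe_smul, Pi.smul_apply, hθB, smul_eq_mul]
      rw [mul_zero, mul_zero, sub_zero, ← mul_assoc, ← pow_two]
      exact Ideal.mul_mem_right _ _ (Ideal.mem_span_singleton_self _)
  choose Q hQ using hP
  -- the fields of the dual basis of `A`, corrected so as to annihilate all `f j`
  let δ' : Fin m → Derivation k A A := fun l => δ l - ∑ i, δ l (f i) • θ i
  have hδ'f : ∀ l j, δ' l (f j) = 0 := by
    intro l j
    simp only [δ', Derivation.coe_sub, Pi.sub_apply]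
    rw [Derivation.sum_apply]
    simp [hθ]
  have hR : ∀ l, ∃ E' : Derivation k B B, ∀ z, E' (algebraMap A B z) = ext (δ' l) z := fun l =>
    hext _ fun j => by simp [hext_apply, hδ'f]
  choose R hR using hR
  let Y : ι → B := fun i => if i = i₀ then t else y i
  have hPf : ∀ i j, P i (f j) = if i = i₀ then y j else if i = j then t else 0 := by
    intro i j
    by_cases hi : i = i₀
    · simp only [P, if_pos hi]
      rw [Derivation.sum_apply]
      simp [hθB]
    · simp [P, if_neg hi, hθB]
  have hRy : ∀ l j, R l (y j) = 0 := by
    intro l j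
    refine h.regular _ _ ?_
    have h1 := congrArg (R l) (hy j)
    rw [(R l).leibniz, hR, hR, hext_apply, hext_apply, hδ'f, hδ'f] at h1
    simpa using h1
  have hQy : ∀ i j, Q i (y j) = if i = i₀ then 0 else if i = j then 1 else 0 := by
    intro i j
    refine h.regular _ _ ?_
    have h1 := congrArg (Q i) (hy j)
    rw [(Q i).leibniz, hQ, hQ, hPf, hPf] at h1
    rw [← ht]
    by_cases hi : i = i₀
    · simp only [if_pos hi, hy0, smul_eq_mul, mul_one] at h1 ⊢
      linear_combination h1
    · simp only [if_neg hi, smul_eq_mul, mul_zero, add_zero] at h1 ⊢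
      rw [h1]
      simp
  refine IsKaehlerDualBasis.projective (ι := Fin m ⊕ ι)
    (x := Sum.elim (fun l => algebraMap A B (x l)) Y) (δ := Sum.elim R Q) ?_
  -- both sides are derivations, so they may be compared on `A` and on the elements `y j`
  let W : Derivation k B Ω[B⁄k] :=
    ∑ l, (LinearMap.toSpanSingleton B Ω[B⁄k] (D k B (algebraMap A B (x l)))).compDer (R l) +
      ∑ i, (LinearMap.toSpanSingleton B Ω[B⁄k] (D k B (Y i))).compDer (Q i)
  have hW : ∀ z, W z = ∑ l, R l z • D k B (algebraMap A B (x l)) + ∑ i, Q i z • D k B (Y i) := by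
    intro z
    simp only [W, Derivation.coe_add, Pi.add_apply]
    rw [Derivation.sum_apply, Derivation.sum_apply]
    rfl
  suffices hDW : D k B = W by
    intro z
    rw [Fintype.sum_sum_type]
    exact (congrArg (· z) hDW).trans (hW z)
  have hDy0 : D k B (y i₀) = 0 := by rw [hy0]; exact Derivation.map_one_eq_zero _
  have hA' : ∀ z : A, D k B (algebraMap A B z) = W (algebraMap A B z) := by
    intro z
    have h1 : ∀ w, D k B (algebraMap A B w) = ∑ l, δ l w • D k B (algebraMap A B (x l)) :=
      fun w => by simpa using hx.apply_eq_sum ((D k B).compAlgebraMap A) w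
    have h2 : ∀ i, D k B (algebraMap A B (f i)) = t • D k B (y i) + y i • D k B t := fun i => by
      rw [← hy, Derivation.leibniz]
    have h3 : ∀ i, Q i (algebraMap A B z) • D k B (Y i) =
        algebraMap A B (θ i z) • t • D k B (y i) +
          if i = i₀ then (∑ j, y j * algebraMap A B (θ j z)) • D k B t else 0 := by
      intro i
      rw [hQ]
      by_cases hi : i = i₀
      · simp only [P, Y, if_pos hi]
        rw [Derivation.sum_apply, hi, hDy0]
        simp [hext_apply]
      · simp [P, Y, if_neg hi, hext_apply, smul_smul, mul_comm]
    rw [hW, Finset.sum_congr rfl fun i _ => h3 i, Finset.sum_add_distrib, Finset.sum_ite_eq',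
      if_pos (Finset.mem_univ _), Finset.sum_smul, ← Finset.sum_add_distrib]
    have h4 : ∀ i, algebraMap A B (θ i z) • t • D k B (y i) +
        (y i * algebraMap A B (θ i z)) • D k B t =
          θ i z • D k B (algebraMap A B (f i)) := by
      intro i
      rw [h2 i, smul_add, algebraMap_smul, ← algebraMap_smul B (θ i z) (y i • D k B t), smul_smul,
        mul_comm]
    rw [Finset.sum_congr rfl fun i _ => h4 i]
    have h5 : ∀ l, R l (algebraMap A B z) • D k B (algebraMap A B (x l)) =
        δ l z • D k B (algebraMap A B (x l)) -
          ∑ i, θ i z • δ l (f i) • D k B (algebraMap A B (x l)) := by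
      intro l
      rw [hR, hext_apply, algebraMap_smul]
      simp only [δ', Derivation.coe_sub, Pi.sub_apply]
      rw [Derivation.sum_apply, sub_smul, Finset.sum_smul]
      simp [smul_smul, mul_comm]
    rw [Finset.sum_congr rfl fun l _ => h5 l, Finset.sum_sub_distrib, Finset.sum_comm, ← h1]
    simp only [← Finset.smul_sum, ← h1, sub_add_cancel]
  have hy' : ∀ j, D k B (y j) = W (y j) := by
    intro j
    rw [hW]
    simp only [hRy, zero_smul, Finset.sum_const_zero, zero_add, hQy]
    by_cases hj : j = i₀
    · subst hj
      rw [hDy0]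
      refine (Finset.sum_eq_zero fun i _ => ?_).symm
      split_ifs <;> simp
    · rw [Finset.sum_eq_single j]
      · simp [hj, Y]
      · intro i _ hij
        simp [hij]
      · simp
  refine Derivation.ext fun z => ?_
  have hz : z ∈ Algebra.adjoin A (Set.range y) := hadj ▸ trivial
  induction hz using Algebra.adjoin_induction with
  | mem z hz => obtain ⟨j, rfl⟩ := hz; exact hy' j
  | algebraMap z => exact hA' z
  | add z w _ _ hz hw => rw [map_add, map_add, hz, hw]
  | mul z w _ _ hz hw => rw [Derivation.leibniz, Derivation.leibniz, hz, hw]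

end IsBlowupChart

/-! ### Ideal quotients and the transform on a chart -/

/-- Quotients by finitely generated ideals commute with localization. -/
theorem Ideal.map_colon {A B : Type*} [CommRing A] [CommRing B] [Algebra A B] (M : Submonoid A)
    [IsLocalization M B] (I : Ideal A) {K : Ideal A} (hK : K.FG) :
    (I.colon (K : Set A)).map (algebraMap A B) =
      (I.map (algebraMap A B)).colon (K.map (algebraMap A B) : Set B) := by
  classical
  apply le_antisymm
  · refine Ideal.map_le_iff_le_comap.mpr fun a ha => ?_
    rw [Ideal.mem_comap, Submodule.mem_colon]
    intro z hz
    refine Submodule.span_induction (p := fun z _ => algebraMap A B a • z ∈ I.map (algebraMap A B))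
      ?_ (by simp) ?_ ?_ hz
    · rintro _ ⟨x, hx, rfl⟩
      rw [smul_eq_mul, ← map_mul]
      exact Ideal.mem_map_of_mem _ (Submodule.mem_colon.mp ha x hx)
    · intro z w _ _ hz hw
      rw [smul_add]
      exact add_mem hz hw
    · intro c z _ hz
      rw [smul_comm]
      exact Ideal.mul_mem_left _ c hz
  · intro z hz
    obtain ⟨⟨a, m⟩, ham⟩ := IsLocalization.surj M z
    obtain ⟨s, rfl⟩ := hK
    have key : ∀ x ∈ s, algebraMap A B (a * x) ∈ I.map (algebraMap A B) := by
      intro x hx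
      have := Submodule.mem_colon.mp hz (algebraMap A B x)
        (Ideal.mem_map_of_mem _ (Ideal.subset_span hx))
      rw [map_mul, ← ham, mul_right_comm]
      exact Ideal.mul_mem_right _ _ this
    have : ∃ n ∈ M, ∀ x ∈ s, n * (a * x) ∈ I := by
      clear hz
      induction s using Finset.induction_on with
      | empty => exact ⟨1, one_mem M, by simp⟩
      | insert x s _ ih =>
        obtain ⟨n, hn, hns⟩ := ih fun y hy => key y (Finset.mem_insert_of_mem hy)
        obtain ⟨n', hn', hx⟩ := (IsLocalization.algebraMap_mem_map_algebraMap_iff M B I _).mp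
          (key x (Finset.mem_insert_self _ _))
        refine ⟨n * n', mul_mem hn hn', fun y hy => ?_⟩
        rcases Finset.mem_insert.mp hy with rfl | hy
        · rw [mul_assoc]
          exact Ideal.mul_mem_left _ _ hx
        · rw [mul_comm n, mul_assoc]
          exact Ideal.mul_mem_left _ _ (hns y hy)
    obtain ⟨n, hn, hns⟩ := this
    refine (IsLocalization.mem_map_algebraMap_iff M B).mpr
      ⟨(⟨n * a, ?_⟩, ⟨n * m, mul_mem hn m.2⟩), ?_⟩
    · rw [Ideal.colon_span, Submodule.mem_colon]
      intro x hx
      rw [smul_eq_mul, mul_assoc]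
      exact hns x hx
    · change z * algebraMap A B (n * m) = algebraMap A B (n * a)
      rw [map_mul, map_mul, ← ham]
      ring

namespace IsBlowupChart

variable {A B : Type*} [CommRing A] [CommRing B] [Algebra A B] {J : Ideal A} {a : A}

theorem mem_colon_iff (h : IsBlowupChart J a B) {I : Ideal B} {n : ℕ} {z : B} :
    z ∈ I.colon ((J.map (algebraMap A B) ^ n : Ideal B) : Set B) ↔
      algebraMap A B a ^ n * z ∈ I := by
  rw [h.map_eq, Ideal.span_singleton_pow, Ideal.mem_colon_span_singleton, mul_comm]

theorem map_eq_mul_colon (h : IsBlowupChart J a B) {I : Ideal A} {n : ℕ} (hI : I ≤ J ^ n) :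
    I.map (algebraMap A B) = J.map (algebraMap A B) ^ n *
      (I.map (algebraMap A B)).colon ((J.map (algebraMap A B) ^ n : Ideal B) : Set B) := by
  apply le_antisymm
  · intro z hz
    have h1 := Ideal.map_mono (f := algebraMap A B) hI hz
    rw [h.map_pow_eq] at h1
    obtain ⟨w, rfl⟩ := Ideal.mem_span_singleton'.mp h1
    rw [mul_comm w] at hz ⊢
    refine Ideal.mul_mem_mul ?_ (h.mem_colon_iff.mpr hz)
    rw [h.map_eq]
    exact Ideal.pow_mem_pow (Ideal.mem_span_singleton_self _) n
  · rw [Ideal.mul_le]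
    intro x hx z hz
    rw [mul_comm]
    exact Submodule.mem_colon.mp hz x hx

theorem pow_mul_cancel (h : IsBlowupChart J a B) {X Y : Ideal B} {n : ℕ}
    (hXY : J.map (algebraMap A B) ^ n * X ≤ J.map (algebraMap A B) ^ n * Y) : X ≤ Y := by
  intro z hz
  rw [h.map_eq, Ideal.span_singleton_pow] at hXY
  obtain ⟨y, hy, hyz⟩ := Ideal.mem_span_singleton_mul.mp
    (hXY (Ideal.mem_span_singleton_mul.mpr ⟨z, hz, rfl⟩))
  rwa [← h.regular_pow n hyz]

/-- The weighted transform of a finitely generated family is finitely generated on each chart: if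
`p.1 Wⁿ`, with `n = p.2`, are generators, then so are `(p.1 / aⁿ) Wⁿ`. -/
theorem isFGFamily_colon (h : IsBlowupChart J a B) {I : ℕ → Ideal A} (hI0 : I 0 = ⊤)
    (hImul : ∀ m n, I m * I n ≤ I (m + n)) (hIJ : ∀ n, I n ≤ J ^ n) (hI : IsFGFamily I) :
    IsFGFamily fun n => ((I n).map (algebraMap A B)).colon
      ((J.map (algebraMap A B) ^ n : Ideal B) : Set B) := by
  classical
  obtain ⟨F, hF1, hF⟩ := isFGFamily_iff.mp hI
  have hw : ∀ p : A × ℕ, ∃ w : B, p ∈ F → algebraMap A B a ^ p.2 * w = algebraMap A B p.1 := by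
    intro p
    by_cases hp : p ∈ F
    · have : p.1 ∈ J ^ p.2 := hIJ _ (hF p.2 ▸ subset_monomialIdeal hp)
      obtain ⟨w, hw⟩ := h.exists_pow_mul_eq this
      exact ⟨w, fun _ => hw⟩
    · exact ⟨0, fun h => absurd h hp⟩
  choose w hw using hw
  refine isFGFamily_iff.mpr ⟨F.image fun p => (w p, p.2), ?_, fun n => le_antisymm ?_ ?_⟩
  · intro q hq
    obtain ⟨p, hp, rfl⟩ := Finset.mem_image.mp hq
    exact hF1 p hp
  · refine monomialIdeal_le (I := fun n => ((I n).map (algebraMap A B)).colon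
      ((J.map (algebraMap A B) ^ n : Ideal B) : Set B)) ?_ ?_ ?_ n
    · refine (Ideal.eq_top_iff_one _).mpr (h.mem_colon_iff.mpr ?_)
      simp [hI0, Ideal.map_top]
    · intro m n
      rw [Ideal.mul_le]
      intro x hx y hy
      rw [h.mem_colon_iff] at hx hy ⊢
      refine Ideal.map_mono (f := algebraMap A B) (hImul m n) ?_
      rw [Ideal.map_mul]
      convert Ideal.mul_mem_mul hx hy using 1
      ring
    · intro q hq
      obtain ⟨p, hp, rfl⟩ := Finset.mem_image.mp (Finset.mem_coe.mp hq)
      rw [h.mem_colon_iff, hw p hp]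
      exact Ideal.mem_map_of_mem _ (hF p.2 ▸ subset_monomialIdeal hp)
  · set G : Set (B × ℕ) := ((F.image fun p => (w p, p.2) : Finset (B × ℕ)) : Set (B × ℕ))
    intro z hz
    rw [h.mem_colon_iff] at hz
    have key : (I n).map (algebraMap A B) ≤
        Ideal.span {algebraMap A B a ^ n} * monomialIdeal G n := by
      rw [Ideal.map_le_iff_le_comap, ← hF n]
      refine monomialIdeal_le (I := fun n =>
        (Ideal.span {algebraMap A B a ^ n} * monomialIdeal G n).comap (algebraMap A B)) ?_ ?_ ?_ n
      · simp [monomialIdeal_zero]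
      · intro m n
        refine (Ideal.le_comap_mul _).trans (Ideal.comap_mono ?_)
        rw [mul_mul_mul_comm, Ideal.span_singleton_mul_span_singleton, ← pow_add]
        exact Ideal.mul_mono_right (Ideal.mul_le.mpr fun x hx y hy => mul_mem_monomialIdeal hx hy)
      · intro p hp
        refine Ideal.mem_span_singleton_mul.mpr ⟨w p, ?_, hw p hp⟩
        exact subset_monomialIdeal (p := (w p, p.2))
          (Finset.mem_coe.mpr (Finset.mem_image_of_mem _ hp))
    obtain ⟨y, hy, hyz⟩ := Ideal.mem_span_singleton_mul.mp (key hz)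
    rwa [← h.regular_pow n hyz]

/-- The property of being a chart is invariant under isomorphism. -/
theorem of_ringEquiv (h : IsBlowupChart J a B) {C : Type*} [CommRing C] [Algebra A C] (e : B ≃+* C)
    (he : ∀ x, e (algebraMap A B x) = algebraMap A C x) : IsBlowupChart J a C where
  mem := h.mem
  regular z z' hz := by
    refine e.symm.injective (h.regular _ _ (e.injective ?_))
    simpa [he] using hz
  map_eq := by
    have : algebraMap A C = (e : B →+* C).comp (algebraMap A B) :=
      RingHom.ext fun x => (he x).symm
    rw [this, ← Ideal.map_map, h.map_eq, Ideal.map_span, Set.image_singleton]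
    rfl
  exists_eq z := by
    obtain ⟨n, p, hp, hz⟩ := h.exists_eq (e.symm z)
    refine ⟨n, p, hp, ?_⟩
    have := congrArg e hz
    simpa [he] using this
  exists_pow_mul_eq_zero p hp := h.exists_pow_mul_eq_zero p (e.injective (by rw [he, hp, map_zero]))

end IsBlowupChart

/-! ### Coordinates along a smooth center -/

/-- Near a prime `p ⊇ J`, the ideal `J` is generated by part of a coordinate system: a subset of
the given generators which is minimal among those generating `J` near `p` is dual to derivations,
up to a factor `g ∉ p`. -/
theorem exists_derivation_apply_eq_ite {k A : Type*} [CommRing k] [CommRing A] [Algebra k A]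
    {J : Ideal A} [Algebra.FormallySmooth k A] [Algebra.FormallySmooth k (A ⧸ J)]
    {ι : Type*} [Fintype ι] [DecidableEq ι] {f : ι → A} (hf : Ideal.span (Set.range f) = J)
    (p : Ideal A) [p.IsPrime] (hJ : J ≤ p) :
    ∃ (s : Finset ι) (g : A) (θ : ι → Derivation k A A), g ∉ p ∧
      (∀ j, g * f j ∈ Ideal.span (f '' s)) ∧
      ∀ i ∈ s, ∀ j ∈ s, θ i (f j) = if i = j then g else 0 := by
  -- a subset `s` which is minimal among those generating `J` near `p`
  have hex : ∃ c, ∃ s : Finset ι, s.card = c ∧ ∃ g ∉ p, ∀ j, g * f j ∈ Ideal.span (f '' s) :=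
    ⟨_, Finset.univ, rfl, 1, fun h => Ideal.IsPrime.ne_top' ((Ideal.eq_top_iff_one p).mpr h),
      fun j => by rw [one_mul]; exact Ideal.subset_span ⟨j, by simp, rfl⟩⟩
  classical
  obtain ⟨s, hs, g, hg, hgs⟩ := Nat.find_spec hex
  have hmin : ∀ i ∈ s, ∀ b, b * f i ∈ Ideal.span (f '' (s.erase i)) → b ∈ p := by
    intro i hi b hb
    by_contra hbp
    refine Nat.find_min hex (m := (s.erase i).card) ?_ ⟨_, rfl, b * g, ?_, fun j => ?_⟩
    · rw [← hs]
      exact Finset.card_erase_lt_of_mem hi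
    · exact fun h => (‹p.IsPrime›.mem_or_mem h).elim hbp hg
    · rw [mul_assoc]
      refine Submodule.span_induction (p := fun z _ => b * z ∈ Ideal.span (f '' (s.erase i)))
        ?_ (by simp) ?_ ?_ (hgs j)
      · rintro _ ⟨l, hl, rfl⟩
        by_cases hli : l = i
        · rw [hli]; exact hb
        · exact Ideal.mul_mem_left _ _ (Ideal.subset_span ⟨l, by simpa [hli] using hl, rfl⟩)
      · intro z w _ _ hz hw
        rw [mul_add]
        exact add_mem hz hw
      · intro c z _ hz
        rw [smul_eq_mul, mul_left_comm]
        exact Ideal.mul_mem_left _ _ hz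
  have hspan : ∀ z ∈ Ideal.span (f '' s), ∃ c : s → A, ∑ l, c l * f l = z := by
    intro z hz
    rw [Set.image_eq_range] at hz
    obtain ⟨c, hc⟩ := (Submodule.mem_span_range_iff_exists_fun A).mp hz
    exact ⟨c, hc⟩
  choose c hc using fun i => hspan _ (hgs i)
  obtain ⟨θ, hθ⟩ := exists_derivation_sum_sub_mem_sq (k := k) J f hf
  have hgJ : ∀ z ∈ J, g * z ∈ Ideal.span (f '' s) := by
    intro z hz
    rw [← hf] at hz
    refine Submodule.span_induction (p := fun z _ => g * z ∈ Ideal.span (f '' s))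
        ?_ (by simp) ?_ ?_ hz
    · rintro _ ⟨l, rfl⟩
      exact hgs l
    · intro z w _ _ hz hw
      rw [mul_add]
      exact add_mem hz hw
    · intro c z _ hz
      rw [smul_eq_mul, mul_left_comm]
      exact Ideal.mul_mem_left _ _ hz
  have hgJ2 : ∀ z ∈ J ^ 2, ∃ b : s → A, (∀ l, b l ∈ J) ∧ ∑ l, b l * f l = g * z := by
    intro z hz
    rw [pow_two] at hz
    refine Submodule.mul_induction_on hz ?_ ?_
    · intro x hx y hy
      obtain ⟨b, hb⟩ := hspan _ (hgJ y hy)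
      refine ⟨fun l => x * b l, fun l => Ideal.mul_mem_right _ _ hx, ?_⟩
      simp only [mul_assoc]
      rw [← Finset.mul_sum, hb]
      ring
    · rintro x y ⟨b, hb, hbx⟩ ⟨b', hb', hby⟩
      refine ⟨fun l => b l + b' l, fun l => add_mem (hb l) (hb' l), ?_⟩
      simp only [add_mul]
      rw [Finset.sum_add_distrib, hbx, hby]
      ring
  let ψ : s → Derivation k A A := fun l => ∑ i, c i l • θ i
  have hψ : ∀ l z, ψ l z = ∑ i, c i l * θ i z := fun l z => by
    simp only [ψ]
    rw [Derivation.sum_apply]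
    rfl
  -- modulo `p` the matrix of the `ψ l (f j)` is `g` times the identity, by minimality of `s`
  let Θ : Matrix s s A := Matrix.of fun l j => ψ l (f j)
  have hΘ : ∀ l j, Θ l j - (if l = j then g else 0) ∈ p := by
    intro l j
    obtain ⟨b, hbJ, hb⟩ := hgJ2 _ (hθ (f j) (hf ▸ Ideal.subset_span ⟨j, rfl⟩))
    have h1 : ∑ l, ((Θ l j - if l = j then g else 0) - b l) * f l = 0 := by
      have h3 : g * ∑ i, θ i (f j) * f i = ∑ l, Θ l j * f l := by
        simp only [Θ, Matrix.of_apply, hψ, Finset.sum_mul]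
        rw [Finset.sum_comm, Finset.mul_sum]
        refine Finset.sum_congr rfl fun i _ => ?_
        rw [mul_left_comm, ← hc, Finset.mul_sum]
        exact Finset.sum_congr rfl fun l _ => by ring
      have h4 : ∑ l : s, (if l = j then g else 0) * f l = g * f j := by simp
      simp only [sub_mul, Finset.sum_sub_distrib]
      rw [← h3, h4, hb]
      ring
    have h2 : (Θ l j - if l = j then g else 0) - b l ∈ p := by
      refine hmin l l.2 _ ?_
      rw [← Finset.add_sum_erase _ _ (Finset.mem_univ l)] at h1
      rw [eq_neg_of_add_eq_zero_left h1]
      refine neg_mem (sum_mem fun i hi => Ideal.mul_mem_left _ _ (Ideal.subset_span ⟨i, ?_, rfl⟩))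
      have : i ≠ l := by simpa using hi
      simp [Subtype.coe_injective.ne this]
    simpa using add_mem h2 (hJ (hbJ l))
  have hdet : Θ.det ∉ p := by
    intro h
    have h1 : (Ideal.Quotient.mk p).mapMatrix Θ =
        Matrix.diagonal fun _ => Ideal.Quotient.mk p g := by
      ext l j
      rw [Matrix.diagonal_apply, RingHom.mapMatrix_apply, Matrix.map_apply]
      have := Ideal.Quotient.eq.mpr (hΘ l j)
      rw [this]
      split_ifs <;> simp
    have h2 := Ideal.Quotient.eq_zero_iff_mem.mpr h
    rw [RingHom.map_det, h1, Matrix.det_diagonal, Finset.prod_const] at h2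
    exact hg (Ideal.Quotient.eq_zero_iff_mem.mp (IsReduced.eq_zero _ ⟨_, h2⟩))
  -- the inverse of the matrix, up to its determinant, makes the derivations dual to the `f j`
  refine ⟨s, Θ.det * g, fun i => if hi : i ∈ s then g • ∑ l, Θ.adjugate ⟨i, hi⟩ l • ψ l else 0,
    fun h => (‹p.IsPrime›.mem_or_mem h).elim hdet hg, fun j => ?_, fun i hi j hj => ?_⟩
  · rw [mul_assoc]
    exact Ideal.mul_mem_left _ _ (hgs j)
  · simp only [dif_pos hi]
    rw [Derivation.coe_smul, Pi.smul_apply, Derivation.sum_apply]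
    have h1 := congrFun (congrFun Θ.adjugate_mul ⟨i, hi⟩) ⟨j, hj⟩
    rw [Matrix.mul_apply, Matrix.smul_apply, Matrix.one_apply] at h1
    simp only [Derivation.coe_smul, Pi.smul_apply, smul_eq_mul]
    simp only [Θ, Matrix.of_apply] at h1 ⊢
    rw [h1]
    by_cases hij : i = j
    · simp [hij, mul_comm]
    · simp [hij]

/-- Near a prime `p ⊇ J`, on the localization at some `g ∉ p`, the ideal `J` is generated by
elements `f j` for which there are derivations `θ i` with `θ i (f j) = δ i j`. -/
theorem exists_coordinates {k A : Type*} [CommRing k] [CommRing A] [Algebra k A]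
    {J : Ideal A} [Algebra.FormallySmooth k A] [Algebra.FormallySmooth k (A ⧸ J)]
    {ι : Type*} [Fintype ι] [DecidableEq ι] {f : ι → A} (hf : Ideal.span (Set.range f) = J)
    (p : Ideal A) [p.IsPrime] (hJ : J ≤ p) :
    ∃ (s : Finset ι) (g : A), g ∉ p ∧ ∀ (B : Type u) [CommRing B] [Algebra A B] [Algebra k B]
      [IsScalarTower k A B] [IsLocalization.Away g B],
      Ideal.span (Set.range fun j : s => algebraMap A B (f j)) = J.map (algebraMap A B) ∧
      ∃ θ : s → Derivation k B B,
        ∀ i j : s, θ i (algebraMap A B (f j)) = if i = j then 1 else 0 := by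
  obtain ⟨s, g, θ, hg, hgs, hθ⟩ := exists_derivation_apply_eq_ite (k := k) hf p hJ
  refine ⟨s, g, hg, fun B _ _ _ _ _ => ⟨?_, ?_⟩⟩
  · have hu : IsUnit (algebraMap A B g) := IsLocalization.Away.algebraMap_isUnit g
    apply le_antisymm
    · rw [Ideal.span_le]
      rintro _ ⟨j, rfl⟩
      exact Ideal.mem_map_of_mem _ (hf ▸ Ideal.subset_span ⟨_, rfl⟩)
    · rw [← hf, Ideal.map_span, Ideal.span_le]
      rintro _ ⟨_, ⟨j, rfl⟩, rfl⟩
      rw [SetLike.mem_coe, ← Ideal.unit_mul_mem_iff_mem _ hu, ← map_mul]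
      have := Ideal.mem_map_of_mem (algebraMap A B) (hgs j)
      rw [Ideal.map_span, ← Set.image_comp] at this
      refine Ideal.span_mono ?_ this
      rintro _ ⟨l, hl, rfl⟩
      exact ⟨(⟨l, hl⟩ : s), rfl⟩
  · choose θ' hθ' using fun i => exists_derivation_extension (B := B) (Submonoid.powers g)
      ((Algebra.linearMap A B).compDer (θ i))
    refine ⟨fun i => IsLocalization.Away.invSelf (S := B) g • θ' i, fun i j => ?_⟩
    have h1 : θ' i (algebraMap A B (f j)) = algebraMap A B (θ i (f j)) := hθ' i (f j)
    rw [Derivation.coe_smul, Pi.smul_apply, h1, hθ i i.2 j j.2]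
    by_cases hij : i = j
    · rw [if_pos hij, if_pos (congrArg Subtype.val hij), smul_eq_mul, mul_comm,
        IsLocalization.Away.mul_invSelf]
    · rw [if_neg hij, if_neg fun h => hij (Subtype.ext h), map_zero, smul_zero]

/-! ### Charts of the Proj of a Rees ring -/

section ReesChart

variable {A : Type u} [CommRing A] (J : Ideal A)

/-- The element `a t` of the Rees ring `A[J t]`. -/
def reesMonomial {a : A} (ha : a ∈ J) : reesAlgebra J :=
  ⟨monomial 1 a, reesAlgebra.monomial_mem.mpr (by simpa using ha)⟩

/-- The ring of the basic open subset `D₊(a t)` of `Proj A[J t]`. -/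
abbrev ReesChart {a : A} (ha : a ∈ J) : Type u :=
  HomogeneousLocalization.Away (reesGrading J) (reesMonomial J ha)

theorem reesMonomial_mem {a : A} (ha : a ∈ J) : reesMonomial J ha ∈ reesGrading J 1 :=
  (mem_reesGrading J).mpr ⟨a, rfl⟩

/-- The map from `A` to the ring of the basic open subset `D₊(a t)` of `Proj A[J t]`. -/
def reesChartMap {a : A} (ha : a ∈ J) :
    A →+* ReesChart J ha :=
  (HomogeneousLocalization.fromZeroRingHom (reesGrading J) _).comp
    (algebraMap A (reesGrading J 0))

theorem val_reesChartMap {a : A} (ha : a ∈ J) (c : A) :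
    (reesChartMap J ha c).val =
      algebraMap _ (Localization.Away (reesMonomial J ha)) (algebraMap A (reesAlgebra J) c) := by
  rw [← Localization.mk_one_eq_algebraMap]
  rfl

/-- The element `(a t)ⁿ cᵈ (p tᵐ)` of the Rees ring as a monomial. -/
theorem reesMonomial_pow_mul_eq {a : A} (ha : a ∈ J) (n : ℕ) (q : reesAlgebra J) {p : A} {m : ℕ}
    (hq : monomial m p = (q : A[X])) (c : A) (d : ℕ) :
    ((reesMonomial J ha ^ n * (algebraMap A (reesAlgebra J) c ^ d * q) : reesAlgebra J) : A[X]) =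
      monomial (n + m) (a ^ n * (c ^ d * p)) := by
  simp only [Subalgebra.coe_mul, Subalgebra.coe_pow, ← hq, reesMonomial, Subalgebra.coe_algebraMap,
    Polynomial.algebraMap_apply, Algebra.algebraMap_self, RingHom.id_apply, monomial_pow, ← map_pow,
    C_mul_monomial, monomial_mul_monomial, one_mul]

/-- The degree zero part of `A[J t]` localized at `a t` is `A[J / a]`, since its elements are the
fractions `(p tⁿ) / (a t)ⁿ` with `p ∈ Jⁿ`. -/
theorem isBlowupChart_reesChartMap {a : A} (ha : a ∈ J) :
    letI := (reesChartMap J ha).toAlgebra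
    IsBlowupChart J a (ReesChart J ha) := by
  let := (reesChartMap J ha).toAlgebra
  let T := reesMonomial J ha
  let L := Localization.Away T
  have hval : ∀ c, (reesChartMap J ha c).val = algebraMap _ L (algebraMap A (reesAlgebra J) c) :=
    val_reesChartMap J ha
  have hTu : IsUnit (algebraMap _ L T) := IsLocalization.Away.algebraMap_isUnit T
  have hinj : Function.Injective (HomogeneousLocalization.val : ReesChart J ha → L) :=
    HomogeneousLocalization.val_injective _
  have hex : ∀ z : ReesChart J ha, ∃ n : ℕ, ∃ p ∈ J ^ n, ∃ q : reesAlgebra J,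
      monomial n p = (q : A[X]) ∧ algebraMap _ L T ^ n * z.val = algebraMap _ L q := by
    intro z
    obtain ⟨n, q, hq, rfl⟩ := HomogeneousLocalization.Away.mk_surjective _ (reesMonomial_mem J ha) z
    rw [smul_eq_mul, mul_one] at hq
    obtain ⟨p, hp⟩ := (mem_reesGrading J).mp hq
    refine ⟨n, p, ?_, q, hp, ?_⟩
    · have := q.2
      rw [← hp] at this
      exact reesAlgebra.monomial_mem.mp this
    · rw [HomogeneousLocalization.Away.val_mk, ← map_pow, Localization.mk_eq_mk']
      exact IsLocalization.mk'_spec' L q (⟨T ^ n, n, rfl⟩ : Submonoid.powers T)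
  have hzero : ∀ q : reesAlgebra J, algebraMap _ L q = 0 → ∃ n : ℕ, T ^ n * q = 0 := by
    intro q hq
    obtain ⟨⟨_, n, rfl⟩, hn⟩ := (IsLocalization.map_eq_zero_iff (Submonoid.powers T) L q).mp hq
    exact ⟨n, hn⟩
  have hreg : ∀ z : ReesChart J ha, reesChartMap J ha a * z = 0 → z = 0 := by
    intro z hz
    obtain ⟨n, p, -, q, hq, hz'⟩ := hex z
    have h1 : algebraMap _ L (algebraMap A (reesAlgebra J) a ^ 1 * q) = 0 := by
      rw [map_mul, pow_one, ← hz', ← hval, mul_left_comm,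
        ← HomogeneousLocalization.val_mul, hz,
        HomogeneousLocalization.val_zero, mul_zero]
    obtain ⟨m, hm⟩ := hzero _ h1
    have h2 := congrArg (Subtype.val) hm
    rw [reesMonomial_pow_mul_eq J ha m q hq a 1] at h2
    have h3 : a ^ (m + 1) * p = 0 := by
      have : monomial (m + n) (a ^ m * (a ^ 1 * p)) = monomial (m + n) (0 : A) := by
        rw [h2]; simp
      rw [← monomial_injective _ this]
      ring
    have h4 : T ^ (m + 1) * (algebraMap A (reesAlgebra J) 1 ^ 1 * q) = 0 := by
      refine Subtype.ext ?_
      rw [reesMonomial_pow_mul_eq J ha (m + 1) q hq 1 1, one_pow, one_mul, h3]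
      simp
    refine hinj ?_
    rw [HomogeneousLocalization.val_zero]
    refine (hTu.pow (m + 1 + n)).mul_left_cancel ?_
    rw [pow_add, mul_assoc, hz', mul_zero, ← map_pow, ← map_mul]
    rw [map_one, one_pow, one_mul] at h4
    rw [h4, map_zero]
  refine ⟨ha, fun z z' hz => ?_, ?_, fun z => ?_, fun p hp => ?_⟩
  · exact (injective_iff_map_eq_zero (AddMonoidHom.mulLeft (reesChartMap J ha a))).mpr hreg hz
  · apply le_antisymm
    · rw [Ideal.map_le_iff_le_comap]
      intro x hx
      rw [Ideal.mem_comap, Ideal.mem_span_singleton']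
      refine ⟨HomogeneousLocalization.Away.mk _ (reesMonomial_mem J ha) 1 (reesMonomial J hx)
        (by simpa using reesMonomial_mem J hx), hinj ?_⟩
      refine (hTu.pow 1).mul_left_cancel ?_
      change algebraMap _ L T ^ 1 * (_ * reesChartMap J ha a).val =
        algebraMap _ L T ^ 1 * (reesChartMap J ha x).val
      rw [HomogeneousLocalization.val_mul, HomogeneousLocalization.Away.val_mk, hval, hval,
        ← mul_assoc, Localization.mk_eq_mk', ← map_pow,
        IsLocalization.mk'_spec' L (reesMonomial J hx) (⟨T ^ 1, 1, rfl⟩ : Submonoid.powers T),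
        ← map_mul, ← map_mul]
      congr 1
      refine Subtype.ext ?_
      simp only [T, reesMonomial, Subalgebra.coe_mul,
        Subalgebra.coe_algebraMap, Polynomial.algebraMap_apply, Algebra.algebraMap_self,
        RingHom.id_apply, pow_one, monomial_mul_C]
      rw [mul_comm]
    · rw [Ideal.span_singleton_le_iff_mem]
      exact Ideal.mem_map_of_mem _ ha
  · obtain ⟨n, p, hp, q, hq, hz⟩ := hex z
    refine ⟨n, p, hp, hinj ((hTu.pow n).mul_left_cancel ?_)⟩
    change algebraMap _ L T ^ n * (reesChartMap J ha a ^ n * z).val =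
      algebraMap _ L T ^ n * (reesChartMap J ha p).val
    rw [HomogeneousLocalization.val_mul, mul_left_comm, hz, HomogeneousLocalization.val_pow, hval,
      hval, ← map_pow (algebraMap _ L), ← map_mul, ← map_pow (algebraMap _ L) T, ← map_mul]
    congr 1
    refine Subtype.ext ?_
    have h1 := reesMonomial_pow_mul_eq J ha 0 q hq a n
    have h2 := reesMonomial_pow_mul_eq J ha n 1 (p := 1) (m := 0) (by simp) p 1
    simp only [pow_zero, one_mul, mul_one, pow_one, zero_add, add_zero] at h1 h2
    rw [h1, h2]
  · have h1 : algebraMap _ L (algebraMap A (reesAlgebra J) p) = 0 := by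
      rw [← hval]
      exact (congrArg HomogeneousLocalization.val hp).trans HomogeneousLocalization.val_zero
    obtain ⟨n, hn⟩ := hzero _ h1
    refine ⟨n, ?_⟩
    have h2 := congrArg (Subtype.val) hn
    have h3 := reesMonomial_pow_mul_eq J ha n 1 (p := 1) (m := 0) (by simp) p 1
    simp only [mul_one, pow_one, add_zero] at h3
    rw [h3] at h2
    refine monomial_injective n ?_
    rw [h2]
    simp

/-- The basic open subsets `D₊(a t)` cover `Proj A[J t]` when `a` runs through generators of `J`. -/
theorem exists_mem_basicOpen_reesMonomial {s : Set A} (hs : Ideal.span s = J)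
    (y : Proj (reesGrading J)) :
    ∃ a, ∃ _ : a ∈ s, ∃ ha : a ∈ J, y ∈ Proj.basicOpen (reesGrading J) (reesMonomial J ha) := by
  classical
  by_contra! H
  simp only [Proj.mem_basicOpen] at H
  let P : Ideal (reesAlgebra J) := y.asHomogeneousIdeal.toIdeal
  -- otherwise the prime `P` of the Rees ring would contain all elements of positive degree
  have h1 : ∀ b ∈ J, ∀ q : reesAlgebra J, (q : A[X]) = monomial 1 b → q ∈ P := by
    intro b hb
    rw [← hs] at hb
    refine Submodule.span_induction (p := fun b _ => ∀ q : reesAlgebra J,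
      (q : A[X]) = monomial 1 b → q ∈ P) ?_ ?_ ?_ ?_ hb
    · intro b hb q hq
      have hbJ : b ∈ J := hs ▸ Ideal.subset_span hb
      have : q = reesMonomial J hbJ := Subtype.ext hq
      rw [this]
      exact not_not.mp (H b hb hbJ)
    · intro q hq
      have : q = 0 := Subtype.ext (by rw [hq]; simp)
      rw [this]
      exact zero_mem P
    · intro b c hb hc hb' hc' q hq
      have : q = reesMonomial J (a := b) (hs ▸ hb) + reesMonomial J (a := c) (hs ▸ hc) :=
        Subtype.ext (by rw [hq, map_add]; rfl)
      rw [this]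
      exact add_mem (hb' _ rfl) (hc' _ rfl)
    · intro c b hb hb' q hq
      have : q = algebraMap A (reesAlgebra J) c * reesMonomial J (a := b) (hs ▸ hb) := by
        refine Subtype.ext ?_
        rw [hq]
        simp [reesMonomial, C_mul_monomial]
      rw [this]
      exact Ideal.mul_mem_left _ _ (hb' _ rfl)
  have h2 : ∀ n : ℕ, ∀ b ∈ J ^ (n + 1), ∀ q : reesAlgebra J,
      (q : A[X]) = monomial (n + 1) b → q ∈ P := by
    intro n b hb
    rw [pow_succ] at hb
    refine Submodule.mul_induction_on' (C := fun b _ => ∀ q : reesAlgebra J,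
      (q : A[X]) = monomial (n + 1) b → q ∈ P) ?_ ?_ hb
    · intro b hb c hc q hq
      have : q = ⟨monomial n b, reesAlgebra.monomial_mem.mpr hb⟩ * reesMonomial J hc :=
        Subtype.ext (by rw [hq, Subalgebra.coe_mul]; exact (monomial_mul_monomial _ _ _ _).symm)
      rw [this]
      exact Ideal.mul_mem_left _ _ (h1 c hc _ rfl)
    · intro b hb c hc hb' hc' q hq
      rw [← pow_succ] at hb hc
      have : q = ⟨monomial (n + 1) b, reesAlgebra.monomial_mem.mpr hb⟩ +
          ⟨monomial (n + 1) c, reesAlgebra.monomial_mem.mpr hc⟩ :=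
        Subtype.ext (by rw [hq, map_add]; rfl)
      rw [this]
      exact add_mem (hb' _ rfl) (hc' _ rfl)
  refine y.not_irrelevant_le fun q hq => ?_
  rw [← DirectSum.sum_support_decompose (reesGrading J) q]
  refine sum_mem fun n _ => ?_
  rcases n with _ | n
  · have := (HomogeneousIdeal.mem_irrelevant_iff _ _).mp hq
    rw [GradedRing.proj_apply] at this
    rw [this]
    exact zero_mem _
  · obtain ⟨b, hb⟩ := (mem_reesGrading J).mp (DirectSum.decompose (reesGrading J) q (n + 1)).2
    refine h2 n b ?_ _ hb.symm
    have := (DirectSum.decompose (reesGrading J) q (n + 1) : reesAlgebra J).2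
    rw [← hb] at this
    exact reesAlgebra.monomial_mem.mp this

theorem awayι_projReesToSpec {a : A} (ha : a ∈ J) :
    Proj.awayι (reesGrading J) (reesMonomial J ha) (reesMonomial_mem J ha) one_pos ≫
      projReesToSpec J = Spec.map (CommRingCat.ofHom (reesChartMap J ha)) := by
  rw [projReesToSpec, Proj.awayι_toSpecZero_assoc, ← Spec.map_comp]
  rfl

end ReesChart

/-! ### Algebras of sections -/

section Sections

variable {k : Type u} [Field k] {V V' : Scheme.{u}}

theorem isScalarTower_appLE (f : V ⟶ Spec (.of k)) (π : V' ⟶ V) {U : V.Opens} {U' : V'.Opens}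
    (h : U' ≤ π ⁻¹ᵁ U) :
    letI := sectionAlgebra f U
    letI := sectionAlgebra (π ≫ f) U'
    letI := (π.appLE U U' h).hom.toAlgebra
    IsScalarTower k Γ(V, U) Γ(V', U') := by
  let := sectionAlgebra f U
  let := sectionAlgebra (π ≫ f) U'
  let := (π.appLE U U' h).hom.toAlgebra
  refine IsScalarTower.of_algebraMap_eq' ?_
  exact congrArg (fun t => ((Scheme.ΓSpecIso (.of k)).inv ≫ t).hom)
    (Scheme.Hom.appLE_comp_appLE π f ⊤ U U' le_top h).symm

theorem isScalarTower_basicOpen (f : V ⟶ Spec (.of k)) {U : V.Opens} (g : Γ(V, U)) :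
    letI := sectionAlgebra f U
    letI := sectionAlgebra f (V.basicOpen g)
    IsScalarTower k Γ(V, U) Γ(V, V.basicOpen g) := by
  let := sectionAlgebra f U
  let := sectionAlgebra f (V.basicOpen g)
  refine IsScalarTower.of_algebraMap_eq' ?_
  exact congrArg (fun t => ((Scheme.ΓSpecIso (.of k)).inv ≫ t).hom)
    (f.appLE_map (U := ⊤) le_top (homOfLE (V.basicOpen_le g)).op).symm

theorem algebraSmooth_sectionAlgebra (f : V ⟶ Spec (.of k)) [Smooth f] {U : V.Opens}
    (hU : IsAffineOpen U) :
    letI := sectionAlgebra f U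
    Algebra.Smooth k Γ(V, U) := by
  have h1 := f.smooth_appLE (isAffineOpen_top _) hU le_top
  have h2 : ((Scheme.ΓSpecIso (.of k)).inv).hom.Smooth :=
    RingHom.Smooth.of_bijective (ConcreteCategory.bijective_of_isIso (Scheme.ΓSpecIso (.of k)).inv)
  exact h2.comp h1

theorem algebraSmooth_quotient (f : V ⟶ Spec (.of k)) (Z : V.IdealSheafData)
    [Smooth (Z.subschemeι ≫ f)] (U : V.affineOpens) :
    letI := sectionAlgebra f U.1
    Algebra.Smooth k (Γ(V, U) ⧸ Z.ideal U) := by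
  let := sectionAlgebra f U.1
  have h1 := (Z.subschemeι ≫ f).smooth_appLE (isAffineOpen_top _) (U.2.preimage Z.subschemeι) le_top
  have h2 : ((Scheme.ΓSpecIso (.of k)).inv).hom.Smooth :=
    RingHom.Smooth.of_bijective (ConcreteCategory.bijective_of_isIso (Scheme.ΓSpecIso (.of k)).inv)
  have h3 : (Z.subschemeObjIso U).hom.hom.Smooth :=
    RingHom.Smooth.of_bijective (ConcreteCategory.bijective_of_isIso (Z.subschemeObjIso U).hom)
  have h4 := (h2.comp h1).comp h3
  have h5 : (Z.subschemeι ≫ f).appLE ⊤ (Z.subschemeι ⁻¹ᵁ U.1) le_top =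
      f.appLE ⊤ U.1 le_top ≫ Z.subschemeι.app U.1 := by
    rw [← Scheme.Hom.appLE_eq_app]
    exact (Scheme.Hom.appLE_comp_appLE _ f ⊤ U.1 _ le_top le_rfl).symm
  rw [h5, Z.subschemeι_app, ← CommRingCat.hom_comp, ← CommRingCat.hom_comp] at h4
  simp only [Category.assoc, Iso.inv_hom_id, Category.comp_id] at h4
  exact h4

/-- On every affine open subset of `V`, the ring of sections is a finitely generated `k`-algebra
with projective module of differentials. -/
def HasProjectiveKaehlerSheaf (f : V ⟶ Spec (.of k)) : Prop :=
  ∀ U : V.affineOpens, letI := sectionAlgebra f U.1; HasProjectiveKaehler k Γ(V, U)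

theorem hasProjectiveKaehlerSheaf_of_smooth (f : V ⟶ Spec (.of k)) [Smooth f] :
    HasProjectiveKaehlerSheaf f := by
  intro U
  let := sectionAlgebra f U.1
  have := algebraSmooth_sectionAlgebra f U.2
  exact Algebra.Smooth.hasProjectiveKaehler

theorem HasProjectiveKaehlerSheaf.of_cover (f : V ⟶ Spec (.of k))
    (h : ∀ x : V, ∃ U : V.affineOpens, x ∈ U.1 ∧
      letI := sectionAlgebra f U.1; HasProjectiveKaehler k Γ(V, U)) :
    HasProjectiveKaehlerSheaf f := by
  choose U hxU hU using h
  intro W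
  refine of_affine_open_cover (P := fun U : V.affineOpens =>
    letI := sectionAlgebra f U.1; HasProjectiveKaehler k Γ(V, U)) U ?_ W ?_ ?_ hU
  · exact top_le_iff.mp fun x _ => TopologicalSpace.Opens.mem_iSup.mpr ⟨x, hxU x⟩
  · intro U g hU
    let := sectionAlgebra f U.1
    let := sectionAlgebra f (V.basicOpen g)
    have := isScalarTower_basicOpen f g
    have := U.2.isLocalization_basicOpen g
    have := @HasProjectiveKaehler.of_isLocalizationAway k Γ(V, U) Γ(V, V.basicOpen g) _ _
      (sectionAlgebra f U.1) _ (sectionAlgebra f (V.basicOpen g)) _ (isScalarTower_basicOpen f g)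
      hU g _
    exact this
  · intro U s hs h
    let := sectionAlgebra f U.1
    let (r : (s : Set Γ(V, U))) := sectionAlgebra f (V.basicOpen r.1)
    have (r : (s : Set Γ(V, U))) := isScalarTower_basicOpen f r.1
    have (r : (s : Set Γ(V, U))) := U.2.isLocalization_basicOpen r.1
    exact HasProjectiveKaehler.of_span_eq_top hs
      (fun r : (s : Set Γ(V, U)) => Γ(V, V.basicOpen r.1)) h

end Sections

/-! ### Inverse images of ideal sheaves -/

namespace AlgebraicGeometry.Scheme

variable {X Y : Scheme.{u}}

theorem Hom.isIso_appLE_of_image_eq (g : X ⟶ Y) [IsOpenImmersion g] {U : Y.Opens} {W : X.Opens}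
    (e : W ≤ g ⁻¹ᵁ U) (h : g ''ᵁ W = U) : IsIso (g.appLE U W e) := by
  subst h
  rw [← g.appIso_hom']
  infer_instance

theorem IdealSheafData.ideal_comap_of_isOpenImmersion_of_le (I : Y.IdealSheafData) (g : X ⟶ Y)
    [IsOpenImmersion g] (U : Y.affineOpens) (W : X.affineOpens) (e : W.1 ≤ g ⁻¹ᵁ U.1) :
    (I.comap g).ideal W = (I.ideal U).map (g.appLE U.1 W.1 e).hom := by
  have hle : g ''ᵁ W.1 ≤ U.1 := Set.image_subset_iff.mpr e
  rw [ideal_comap_of_isOpenImmersion]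
  have h1 := I.map_ideal (U := ⟨g ''ᵁ W.1, W.2.image_of_isOpenImmersion g⟩) (V := U) hle
  rw [← h1, ← g.map_appLE (Hom.preimage_image_eq g W.1).ge (homOfLE hle).op, ← g.appIso_hom',
    CommRingCat.hom_comp, ← Ideal.map_map]
  exact Ideal.comap_symm (g.appIso W.1).commRingCatIsoToRingEquiv

theorem IdealSheafData.ideal_comap_top [IsAffine X] [IsAffine Y] (I : Y.IdealSheafData)
    (f : X ⟶ Y) : (I.comap f).ideal ⟨⊤, isAffineOpen_top X⟩ =
      (I.ideal ⟨⊤, isAffineOpen_top Y⟩).map (f.appLE ⊤ ⊤ le_top).hom := by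
  refine eq_of_forall_ge_iff fun L => ?_
  have hL : (ofIdealTop L).ideal ⟨⊤, isAffineOpen_top X⟩ = L := by simp
  have h1 := IdealSheafData.le_map_iff_comap_le (I := ofIdealTop L) (f := f) (J := I)
  have h2 : (I.comap f).ideal ⟨⊤, isAffineOpen_top X⟩ ≤ L ↔ I.comap f ≤ ofIdealTop L :=
    ⟨fun h => le_of_isAffine (h.trans hL.ge), fun h => (h _).trans hL.le⟩
  have h3 := ideal_map_of_isAffineHom (ofIdealTop L) f ⟨⊤, isAffineOpen_top Y⟩
  rw [h2, ← h1, Ideal.map_le_iff_le_comap]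
  have h4 : ((ofIdealTop L).map f).ideal ⟨⊤, isAffineOpen_top Y⟩ =
      L.comap (f.appLE ⊤ ⊤ le_top).hom := by
    rw [h3]
    refine congrArg₂ (fun (φ : Γ(Y, ⊤) ⟶ Γ(X, ⊤)) K => Ideal.comap φ.hom K) ?_ hL
    exact (f.appLE_eq_app).symm
  exact ⟨fun h => (h _).trans h4.le, fun h => le_of_isAffine (h.trans h4.ge)⟩

theorem IdealSheafData.ideal_comap_of_comm (I : Y.IdealSheafData) (f : X ⟶ Y) (U : Y.affineOpens)
    (W : X.affineOpens) (e : W.1 ≤ f ⁻¹ᵁ U.1) {S T : Scheme.{u}} [IsAffine S] [IsAffine T]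
    (g : S ⟶ Y) (g' : T ⟶ X) [IsOpenImmersion g] [IsOpenImmersion g'] (φ : T ⟶ S)
    (hφ : φ ≫ g = g' ≫ f) (eg : ⊤ ≤ g ⁻¹ᵁ U.1) (eg' : ⊤ ≤ g' ⁻¹ᵁ W.1) (himage : g' ''ᵁ ⊤ = W.1) :
    (I.comap f).ideal W = (I.ideal U).map (f.appLE U.1 W.1 e).hom := by
  have := g'.isIso_appLE_of_image_eq eg' himage
  have h1 := (I.comap f).ideal_comap_of_isOpenImmersion_of_le g' W ⟨⊤, isAffineOpen_top _⟩ eg'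
  have h2 := I.ideal_comap_of_isOpenImmersion_of_le g U ⟨⊤, isAffineOpen_top _⟩ eg
  have h3 := (I.comap g).ideal_comap_top φ
  rw [← comap_comp] at h1 h3
  rw [hφ, h1, h2, Ideal.map_map, ← CommRingCat.hom_comp] at h3
  have h4 : g.appLE U.1 ⊤ eg ≫ φ.appLE ⊤ ⊤ le_top =
      f.appLE U.1 W.1 e ≫ g'.appLE W.1 ⊤ eg' := by
    rw [Scheme.Hom.appLE_comp_appLE]
    refine (Scheme.Hom.appLE_comp_appLE _ _ _ _ _ _ _).trans ?_
    simp only [hφ]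
  rw [h4, CommRingCat.hom_comp, ← Ideal.map_map] at h3
  have h5 := ConcreteCategory.bijective_of_isIso (g'.appLE W.1 ⊤ eg')
  have h6 := congrArg (Ideal.comap (g'.appLE W.1 ⊤ eg').hom) h3
  rwa [Ideal.comap_map_of_bijective _ h5, Ideal.comap_map_of_bijective _ h5] at h6

/-- The inverse image of an ideal sheaf is given by extension of ideals on affine open sets. -/
theorem IdealSheafData.ideal_comap (I : Y.IdealSheafData) (f : X ⟶ Y) (U : Y.affineOpens)
    (W : X.affineOpens) (e : W.1 ≤ f ⁻¹ᵁ U.1) :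
    (I.comap f).ideal W = (I.ideal U).map (f.appLE U.1 W.1 e).hom := by
  have hU : IsAffineOpen U.1 := U.2
  have hW : IsAffineOpen W.1 := W.2
  exact I.ideal_comap_of_comm f U W e hU.fromSpec hW.fromSpec (Spec.map (f.appLE U.1 W.1 e))
    (hU.SpecMap_appLE_fromSpec f hW e) hU.fromSpec_preimage_self.ge
    hW.fromSpec_preimage_self.ge
    (by rw [Hom.image_top_eq_opensRange, IsAffineOpen.opensRange_fromSpec])

end AlgebraicGeometry.Scheme

/-! ### Affine charts of a blow-up -/

theorem fromSpec_appLE {V : Scheme.{u}} {U : V.Opens} (hU : IsAffineOpen U) :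
    hU.fromSpec.appLE U ⊤ hU.fromSpec_preimage_self.ge = (Scheme.ΓSpecIso Γ(V, U)).inv := by
  rw [Scheme.Hom.appLE, hU.fromSpec_app_self, Category.assoc, ← Functor.map_comp]
  exact (congrArg _ ((Spec Γ(V, U)).presheaf.map_id _)).trans (Category.comp_id _)

theorem appLE_comp_appLE_of_comm {V V' : Scheme.{u}} (π : V' ⟶ V) {U : V.Opens}
    (hU : IsAffineOpen U) {B : CommRingCat.{u}} (j : Spec B ⟶ V') (φ : Γ(V, U) ⟶ B)
    (hj : j ≫ π = Spec.map φ ≫ hU.fromSpec) {U' : V'.Opens} (e : U' ≤ π ⁻¹ᵁ U)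
    (e' : ⊤ ≤ j ⁻¹ᵁ U') :
    π.appLE U U' e ≫ j.appLE U' ⊤ e' = φ ≫ (Scheme.ΓSpecIso B).inv := by
  rw [Scheme.ΓSpecIso_inv_naturality, ← fromSpec_appLE hU]
  refine (Scheme.Hom.appLE_comp_appLE _ _ _ _ _ _ _).trans ?_
  simp only [hj]
  exact (Scheme.Hom.appLE_comp_appLE (Spec.map φ) hU.fromSpec U ⊤ ⊤
    hU.fromSpec_preimage_self.ge le_top).symm.trans
    (congrArg (_ ≫ ·) (Scheme.Hom.appLE_eq_app (Spec.map φ)))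

/-- The ring of sections over the range of an affine open immersion. -/
theorem exists_iso_opensRange {V V' : Scheme.{u}} (π : V' ⟶ V) {U : V.Opens}
    (hU : IsAffineOpen U) {B : CommRingCat.{u}} (j : Spec B ⟶ V') [IsOpenImmersion j]
    (φ : Γ(V, U) ⟶ B) (hj : j ≫ π = Spec.map φ ≫ hU.fromSpec) (e : j.opensRange ≤ π ⁻¹ᵁ U) :
    ∃ iso : B ≅ Γ(V', j.opensRange), φ ≫ iso.hom = π.appLE U j.opensRange e := by
  have := j.isIso_appLE_of_image_eq (j.preimage_opensRange.ge) j.image_top_eq_opensRange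
  have hψ := appLE_comp_appLE_of_comm π hU j φ hj e j.preimage_opensRange.ge
  refine ⟨(Scheme.ΓSpecIso B).symm ≪≫ (asIso (j.appLE _ ⊤ j.preimage_opensRange.ge)).symm, ?_⟩
  rw [Iso.trans_hom, Iso.symm_hom, Iso.symm_hom, asIso_inv, ← Category.assoc, ← hψ,
    Category.assoc, IsIso.hom_inv_id, Category.comp_id]

theorem exists_chart_of_isOpenImmersion {V V' : Scheme.{u}} (π : V' ⟶ V) (U : V.affineOpens)
    {J : Ideal Γ(V, U)} {a : Γ(V, U)} {B : CommRingCat.{u}} (j : Spec B ⟶ V') [IsOpenImmersion j]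
    (φ : Γ(V, U) ⟶ B) {hU : IsAffineOpen U.1} (hj : j ≫ π = Spec.map φ ≫ hU.fromSpec)
    (hB : letI := φ.hom.toAlgebra; IsBlowupChart J a B) (e : j.opensRange ≤ π ⁻¹ᵁ U.1) :
    letI := (π.appLE U.1 j.opensRange e).hom.toAlgebra
    IsBlowupChart J a Γ(V', j.opensRange) := by
  obtain ⟨iso, hiso⟩ := exists_iso_opensRange π hU j φ hj e
  let := (π.appLE U.1 j.opensRange e).hom.toAlgebra
  let := φ.hom.toAlgebra
  refine IsBlowupChart.of_ringEquiv hB iso.commRingCatIsoToRingEquiv fun x => ?_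
  exact congrArg (fun t => t.hom x) hiso

/-- The open immersion of the basic open subset `D₊(a t)` into the blow-up. -/
theorem exists_isOpenImmersion_of_iso_proj {V V' : Scheme.{u}} {π : V' ⟶ V} {U : V.Opens}
    (hU : IsAffineOpen U) {J : Ideal Γ(V, U)} (e : (π ⁻¹ᵁ U).toScheme ≅ Proj (reesGrading J))
    (he : e.hom ≫ projReesToSpec J = (π ∣_ U) ≫ hU.isoSpec.hom) {a : Γ(V, U)} (ha : a ∈ J) :
    ∃ j : Spec (.of (ReesChart J ha)) ⟶ V', ∃ _ : IsOpenImmersion j,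
      j ≫ π = Spec.map (CommRingCat.ofHom (reesChartMap J ha)) ≫ hU.fromSpec ∧
      j.opensRange ≤ π ⁻¹ᵁ U ∧
      ∀ p, e.hom p ∈ Proj.basicOpen (reesGrading J) (reesMonomial J ha) →
        (π ⁻¹ᵁ U).ι p ∈ Set.range j := by
  let j₀ := Proj.awayι (reesGrading J) (reesMonomial _ ha) (reesMonomial_mem _ ha) one_pos
  refine ⟨j₀ ≫ e.inv ≫ (π ⁻¹ᵁ U).ι, inferInstance, ?_, ?_, fun p hp => ?_⟩
  · rw [← awayι_projReesToSpec J ha]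
    simp only [Category.assoc]
    rw [← morphismRestrict_ι, ← hU.isoSpec_hom_fromSpec, ← Category.assoc (π ∣_ U), ← he]
    simp [j₀]
  · rintro _ ⟨z, rfl⟩
    simp only [Scheme.Hom.comp_apply]
    exact Subtype.prop _
  · rw [← Proj.opensRange_awayι _ _ (reesMonomial_mem _ ha) one_pos] at hp
    obtain ⟨z, hz⟩ := hp
    refine ⟨z, ?_⟩
    have h1 : j₀ z = e.hom p := hz
    simp [h1]

/-- A blow-up is covered by affine charts of the form `A[J / a]`. -/
theorem IsBlowup.exists_chart {V V' : Scheme.{u}} {π : V' ⟶ V} {Z : V.IdealSheafData}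
    (hπ : IsBlowup π Z) (x' : V') (U : V.affineOpens) (hx : π x' ∈ U.1) {s : Set Γ(V, U)}
    (hs : Ideal.span s = Z.ideal U) :
    ∃ (U' : V'.affineOpens) (e : U'.1 ≤ π ⁻¹ᵁ U.1), x' ∈ U'.1 ∧ ∃ a ∈ s,
      letI := (π.appLE U.1 U'.1 e).hom.toAlgebra
      IsBlowupChart (Z.ideal U) a Γ(V', U') := by
  have hU : IsAffineOpen U.1 := U.2
  obtain ⟨e, he⟩ := hπ U
  obtain ⟨p, rfl⟩ : ∃ p : (π ⁻¹ᵁ U.1).toScheme, (π ⁻¹ᵁ U.1).ι p = x' := ⟨⟨x', hx⟩, rfl⟩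
  obtain ⟨a, has, ha, hy⟩ := exists_mem_basicOpen_reesMonomial (Z.ideal U) hs (e.hom p)
  obtain ⟨j, _, hj, hle, hjp⟩ := exists_isOpenImmersion_of_iso_proj hU e he ha
  exact ⟨⟨j.opensRange, isAffineOpen_opensRange j⟩, hle, hjp p hy, a, has,
    exists_chart_of_isOpenImmersion π U j _ hj (isBlowupChart_reesChartMap (Z.ideal U) ha) hle⟩

/-! ### Diff-algebras and differential hulls over a scheme -/

section DiffAlgebra

variable {k : Type u} [Field k] {V : Scheme.{u}}

/-- Stability under derivations is a local property, and is inherited by all affine open sets. -/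
theorem DerivationClosed.of_affine_cover {f : V ⟶ Spec (.of k)} (hf : HasProjectiveKaehlerSheaf f)
    {I : ℕ → V.IdealSheafData} (hI : ∀ n, I (n + 1) ≤ I n)
    (h : ∀ x : V, ∃ U : V.affineOpens, x ∈ U.1 ∧
      letI := sectionAlgebra f U.1; DerivationClosed k fun n => (I n).ideal U) (W : V.affineOpens) :
    letI := sectionAlgebra f W.1; DerivationClosed k fun n => (I n).ideal W := by
  choose U hxU hU using h
  refine of_affine_open_cover (P := fun U : V.affineOpens =>
    letI := sectionAlgebra f U.1; DerivationClosed k fun n => (I n).ideal U) U ?_ W ?_ ?_ hU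
  · exact top_le_iff.mp fun x _ => TopologicalSpace.Opens.mem_iSup.mpr ⟨x, hxU x⟩
  · intro U g hU
    have := @DerivationClosed.map k Γ(V, U) Γ(V, V.basicOpen g) _ _ (sectionAlgebra f U.1) _
      (sectionAlgebra f (V.basicOpen g)) _ (isScalarTower_basicOpen f g) (hf U)
      (fun n => (I n).ideal U) hU fun n => hI n U
    have heq : (fun n => (I n).ideal (V.affineBasicOpen g)) = fun n =>
        ((I n).ideal U).map (algebraMap Γ(V, U) Γ(V, V.basicOpen g)) :=
      funext fun n => ((I n).map_ideal_basicOpen U g).symm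
    rw [heq]
    exact this
  · intro U s hs h
    refine @DerivationClosed.of_span_eq_top k Γ(V, U) _ _ (sectionAlgebra f U.1) s hs
      (fun r : (s : Set Γ(V, U)) => Γ(V, V.basicOpen r.1)) _ _
      (fun r => U.2.isLocalization_basicOpen r.1) (fun r => sectionAlgebra f _)
      (fun r => isScalarTower_basicOpen f r.1) _ fun r => ?_
    have heq : (fun n => (I n).ideal (V.affineBasicOpen r.1)) = fun n =>
        ((I n).ideal U).map (algebraMap Γ(V, U) Γ(V, V.basicOpen r.1)) :=
      funext fun n => ((I n).map_ideal_basicOpen U r.1).symm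
    rw [← heq]
    exact h r

/-- A Rees algebra is a Diff-algebra if and only if it is stable under derivations on all affine
open sets. -/
theorem isDiffAlgebra_iff [CharZero k] {f : V ⟶ Spec (.of k)} (hf : HasProjectiveKaehlerSheaf f)
    {𝒦 : ReesAlg V} : IsDiffAlgebra f 𝒦 ↔ ∀ U : V.affineOpens,
      letI := sectionAlgebra f U.1; IsDiffFamily k fun n => (𝒦.I n).ideal U := by
  constructor
  · intro h U
    refine @IsDiffFamily.mk k Γ(V, U) _ _ (sectionAlgebra f U.1) _ ?_ (fun m n => 𝒦.mul_le m n U)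
      (fun n => h.succ_le n U) ?_
    · rw [𝒦.I_zero]
      rfl
    · refine DerivationClosed.of_affine_cover hf h.succ_le (fun x => ?_) U
      obtain ⟨W, hxW, hW⟩ := h.diff_mem x
      refine ⟨W, hxW, ?_⟩
      let := sectionAlgebra f W.1
      intro E n a ha
      exact hW 1 (n + 1) (by omega) E (Derivation.isDiffOp_one E) a ha
  · intro h
    refine ⟨fun n U => @IsDiffFamily.succ_le k Γ(V, U) _ _ (sectionAlgebra f U.1) _ (h U) n,
      fun x => ?_⟩
    obtain ⟨_, ⟨W, hW, rfl⟩, hxW, -⟩ :=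
      V.isBasis_affineOpens.exists_subset_of_mem_open (Set.mem_univ x) isOpen_univ
    refine ⟨⟨W, hW⟩, hxW, fun r n hrn E hE a ha => ?_⟩
    have hK := h ⟨W, hW⟩
    let := sectionAlgebra f W
    exact DerivationClosed.diffOp_mem (hf ⟨W, hW⟩) hK.derivationClosed hK.succ_le hrn hE ha

/-- The differential hull of a Rees algebra, formed over every affine open set. -/
def ReesAlg.diffHull {f : V ⟶ Spec (.of k)} (hf : HasProjectiveKaehlerSheaf f) (𝒢 : ReesAlg V) :
    ReesAlg V where
  I n :=
    { ideal := fun U => @_root_.diffHull k Γ(V, U) _ _ (sectionAlgebra f U.1)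
        (fun n => (𝒢.I n).ideal U) n
      map_ideal_basicOpen := fun U g => by
        have := @map_diffHull k Γ(V, U) Γ(V, V.basicOpen g) _ _ (sectionAlgebra f U.1) _
          (sectionAlgebra f (V.basicOpen g)) _ (isScalarTower_basicOpen f g) (hf U) _
          (U.2.isLocalization_basicOpen g) (fun n => (𝒢.I n).ideal U) n
        have heq : (fun n => (𝒢.I n).ideal (V.affineBasicOpen g)) = fun n =>
            ((𝒢.I n).ideal U).map (algebraMap Γ(V, U) Γ(V, V.basicOpen g)) :=
          funext fun n => ((𝒢.I n).map_ideal_basicOpen U g).symm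
        rw [heq]
        exact this }
  I_zero := Scheme.IdealSheafData.ext (funext fun U =>
    @IsDiffFamily.zero k Γ(V, U) _ _ (sectionAlgebra f U.1) _
      (@isDiffFamily_diffHull k Γ(V, U) _ _ (sectionAlgebra f U.1) fun n => (𝒢.I n).ideal U))
  mul_le m n U := @IsDiffFamily.mul_le k Γ(V, U) _ _ (sectionAlgebra f U.1) _
    (@isDiffFamily_diffHull k Γ(V, U) _ _ (sectionAlgebra f U.1) fun n => (𝒢.I n).ideal U) m n
  finite_gen U := @IsFGFamily.diffHull Γ(V, U) _ k _ (sectionAlgebra f U.1) (hf U)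
    (fun n => (𝒢.I n).ideal U) (𝒢.finite_gen U)

theorem ReesAlg.isDiffHull_diffHull [CharZero k] {f : V ⟶ Spec (.of k)}
    (hf : HasProjectiveKaehlerSheaf f) (𝒢 : ReesAlg V) : IsDiffHull f 𝒢 (𝒢.diffHull hf) := by
  refine ⟨⟨(isDiffAlgebra_iff hf).mpr fun U => ?_, fun n U => ?_⟩, fun 𝒦 h𝒦 n U => ?_⟩
  · exact @isDiffFamily_diffHull k Γ(V, U) _ _ (sectionAlgebra f U.1) fun n => (𝒢.I n).ideal U
  · exact @le_diffHull k Γ(V, U) _ _ (sectionAlgebra f U.1) (fun n => (𝒢.I n).ideal U) n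
  · exact @diffHull_le k Γ(V, U) _ _ (sectionAlgebra f U.1) _ _
      ((isDiffAlgebra_iff hf).mp h𝒦.1 U) (fun m => h𝒦.2 m U) n

end DiffAlgebra

/-! ### The singular locus -/

theorem isDiffFamily_symbolicPow (k : Type*) {A : Type*} [Field k] [CommRing A] [Algebra k A]
    (p : Ideal A) [hp : p.IsPrime] : IsDiffFamily k (symbolicPow p) where
  zero := (Ideal.eq_top_iff_one _).mpr
    ⟨1, fun h => hp.ne_top ((Ideal.eq_top_iff_one p).mpr h), by simp⟩
  mul_le m n := by
    rw [Ideal.mul_le]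
    rintro a ⟨s, hs, hsa⟩ b ⟨t, ht, htb⟩
    refine ⟨s * t, fun h => (hp.mem_or_mem h).elim hs ht, ?_⟩
    rw [mul_mul_mul_comm, pow_add]
    exact Ideal.mul_mem_mul hsa htb
  succ_le n := by
    rintro a ⟨s, hs, hsa⟩
    exact ⟨s, hs, Ideal.pow_le_pow_right n.le_succ hsa⟩
  derivationClosed := derivationClosed_symbolicPow p

theorem map_le_maximalIdeal_pow_iff {A B : Type*} [CommRing A] [CommRing B] [Algebra A B]
    (p : Ideal A) [p.IsPrime] [IsLocalRing B] [IsLocalization.AtPrime B p] (I : Ideal A) (n : ℕ) :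
    I.map (algebraMap A B) ≤ IsLocalRing.maximalIdeal B ^ n ↔ I ≤ symbolicPow p n := by
  rw [Ideal.map_le_iff_le_comap, ← IsLocalization.AtPrime.map_eq_maximalIdeal p B, ← Ideal.map_pow]
  refine forall_congr' fun a => imp_congr_right fun _ => ?_
  rw [Ideal.mem_comap, IsLocalization.algebraMap_mem_map_algebraMap_iff p.primeCompl B]
  rfl

section Sing

variable {k : Type u} [Field k] {V : Scheme.{u}}

/-- The order of an ideal sheaf at a point, in terms of symbolic powers. -/
theorem map_germ_le_maximalIdeal_pow_iff {U : V.affineOpens} {x : V} (hx : x ∈ U.1)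
    (I : Ideal Γ(V, U)) (n : ℕ) :
    I.map (V.presheaf.germ U.1 x hx).hom ≤ IsLocalRing.maximalIdeal (V.presheaf.stalk x) ^ n ↔
      I ≤ symbolicPow (U.2.primeIdealOf ⟨x, hx⟩).asIdeal n :=
  @map_le_maximalIdeal_pow_iff Γ(V, U) (V.presheaf.stalk x) _ _
    (V.presheaf.germ U.1 x hx).hom.toAlgebra
    (U.2.primeIdealOf ⟨x, hx⟩).asIdeal _ _ (U.2.isLocalization_stalk ⟨x, hx⟩) I n

theorem mem_support_iff_le_primeIdealOf {Z : V.IdealSheafData} {U : V.affineOpens} {x : V}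
    (hx : x ∈ U.1) : x ∈ Z.support ↔ Z.ideal U ≤ (U.2.primeIdealOf ⟨x, hx⟩).asIdeal := by
  have hU : IsAffineOpen U.1 := U.2
  have h1 : hU.fromSpec (hU.primeIdealOf ⟨x, hx⟩) = x := hU.fromSpec_primeIdealOf ⟨x, hx⟩
  have h2 : hU.fromSpec (hU.primeIdealOf ⟨x, hx⟩) ∈ V.zeroLocus (Z.ideal U : Set Γ(V, U)) ↔
      Z.ideal U ≤ (hU.primeIdealOf ⟨x, hx⟩).asIdeal :=
    Set.ext_iff.mp (hU.fromSpec_preimage_zeroLocus (Z.ideal U)) (hU.primeIdealOf ⟨x, hx⟩)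
  rw [h1] at h2
  exact (Scheme.IdealSheafData.mem_support_iff_of_mem hx).trans h2

theorem exists_primeIdealOf_eq {U : V.Opens} (hU : IsAffineOpen U) (p : PrimeSpectrum Γ(V, U)) :
    ∃ (x : V) (hx : x ∈ U), hU.primeIdealOf ⟨x, hx⟩ = p := by
  have hx : hU.fromSpec p ∈ U := by
    rw [← SetLike.mem_coe, ← hU.range_fromSpec]
    exact ⟨p, rfl⟩
  exact ⟨_, hx, hU.fromSpec.isOpenEmbedding.injective (hU.fromSpec_primeIdealOf ⟨_, hx⟩)⟩

/-- Passing to the differential hull does not shrink the singular locus. -/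
theorem ReesAlg.Sing_subset_Sing_diffHull {f : V ⟶ Spec (.of k)}
    (hf : HasProjectiveKaehlerSheaf f) (𝒢 : ReesAlg V) : 𝒢.Sing ⊆ (𝒢.diffHull hf).Sing := by
  intro x hx n _ U hxU
  rw [map_germ_le_maximalIdeal_pow_iff]
  have hK := @isDiffFamily_symbolicPow k Γ(V, U) _ _ (sectionAlgebra f U.1)
    (U.2.primeIdealOf ⟨x, hxU⟩).asIdeal _
  refine @diffHull_le k Γ(V, U) _ _ (sectionAlgebra f U.1) _ _ hK (fun m => ?_) n
  rcases m.eq_zero_or_pos with rfl | hm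
  · have h0 := @IsDiffFamily.zero k Γ(V, U) _ _ (sectionAlgebra f U.1) _ hK
    rw [h0]
    exact le_top
  · exact (map_germ_le_maximalIdeal_pow_iff hxU _ m).mp (hx m hm U hxU)

theorem ReesAlg.ideal_le_pow_of_support_subset_Sing [CharZero k] (f : V ⟶ Spec (.of k)) [Smooth f]
    {𝒢 : ReesAlg V} {Z : V.IdealSheafData} [Smooth (Z.subschemeι ≫ f)]
    (hZ : (Z.support : Set V) ⊆ 𝒢.Sing) (U : V.affineOpens) (n : ℕ) :
    (𝒢.I n).ideal U ≤ Z.ideal U ^ n := by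
  rcases n.eq_zero_or_pos with rfl | hn
  · simp
  intro h hh
  have hU : IsAffineOpen U.1 := U.2
  let := sectionAlgebra f U.1
  have := algebraSmooth_sectionAlgebra f hU
  have := algebraSmooth_quotient f Z U
  refine mem_pow_of_forall_mem_symbolicPow (k := k) fun p hp hJp => ?_
  obtain ⟨x, hx, hxp⟩ := exists_primeIdealOf_eq hU ⟨p, hp⟩
  have h1 : (hU.primeIdealOf ⟨x, hx⟩).asIdeal = p := congrArg PrimeSpectrum.asIdeal hxp
  have h2 : x ∈ Z.support := (mem_support_iff_le_primeIdealOf hx).mpr (hJp.trans h1.ge)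
  have h3 := (map_germ_le_maximalIdeal_pow_iff hx _ n).mp (hZ h2 n hn U hx) hh
  obtain ⟨s, hs, hsh⟩ := h3
  exact ⟨s, by rwa [h1] at hs, by rwa [h1] at hsh⟩

end Sing

/-! ### Differentials of a blow-up -/

section BlowupKaehler

variable {k : Type u} [Field k] {V V' : Scheme.{u}}

theorem mem_basicOpen_of_notMem_primeIdealOf {U : V.Opens} (hU : IsAffineOpen U) {x : V}
    (hx : x ∈ U) {g : Γ(V, U)} (hg : g ∉ (hU.primeIdealOf ⟨x, hx⟩).asIdeal) :
    x ∈ V.basicOpen g := by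
  rw [← hU.fromSpec_image_basicOpen]
  exact ⟨_, hg, hU.fromSpec_primeIdealOf ⟨x, hx⟩⟩

theorem HasProjectiveKaehlerSheaf.isNoetherianRing {f : V ⟶ Spec (.of k)}
    (hf : HasProjectiveKaehlerSheaf f) (U : V.affineOpens) : IsNoetherianRing Γ(V, U) := by
  let := sectionAlgebra f U.1
  have := (hf U).finiteType
  exact Algebra.FiniteType.isNoetherianRing k _

theorem exists_mem_affineOpens (x : V) : ∃ U : V.affineOpens, x ∈ U.1 := by
  obtain ⟨_, ⟨W, hW, rfl⟩, hxW, -⟩ :=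
    V.isBasis_affineOpens.exists_subset_of_mem_open (Set.mem_univ x) isOpen_univ
  exact ⟨⟨W, hW⟩, hxW⟩

theorem IsBlowup.exists_affineOpens_hasProjectiveKaehler {f : V ⟶ Spec (.of k)} [Smooth f]
    {Z : V.IdealSheafData} [Smooth (Z.subschemeι ≫ f)] {π : V' ⟶ V} (hπ : IsBlowup π Z) (x' : V') :
    ∃ U' : V'.affineOpens, x' ∈ U'.1 ∧
      letI := sectionAlgebra (π ≫ f) U'.1; HasProjectiveKaehler k Γ(V', U') := by
  classical
  have hf := hasProjectiveKaehlerSheaf_of_smooth f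
  obtain ⟨U, hx⟩ := exists_mem_affineOpens (π x')
  have hU : IsAffineOpen U.1 := U.2
  have := hf.isNoetherianRing U
  set p := (hU.primeIdealOf ⟨π x', hx⟩).asIdeal with hp
  by_cases hZp : Z.ideal U ≤ p
  · -- near a point of the center, part of a coordinate system generates the ideal of the center
    let := sectionAlgebra f U.1
    have := algebraSmooth_sectionAlgebra f hU
    have := algebraSmooth_quotient f Z U
    obtain ⟨t, ht⟩ := (isNoetherianRing_iff_ideal_fg Γ(V, U)).mp ‹_› (Z.ideal U)
    obtain ⟨s, g, hg, hs⟩ := exists_coordinates (k := k)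
      (f := (Subtype.val : t → Γ(V, U))) (by simpa using ht) p hZp
    obtain ⟨hspan, θ, hθ⟩ := @hs Γ(V, V.basicOpen g) _ _ (sectionAlgebra f (V.basicOpen g))
      (isScalarTower_basicOpen f g) (hU.isLocalization_basicOpen g)
    have hspan' := hspan.trans (Z.map_ideal_basicOpen U g)
    obtain ⟨U', e, hx', a, ⟨i₀, rfl⟩, hchart⟩ := hπ.exists_chart x' (V.affineBasicOpen g)
      (mem_basicOpen_of_notMem_primeIdealOf hU hx hg) hspan'
    exact ⟨U', hx', @IsBlowupChart.hasProjectiveKaehler k Γ(V, V.basicOpen g) Γ(V', U') _ _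
      (sectionAlgebra f (V.basicOpen g)) _ (sectionAlgebra (π ≫ f) U'.1)
      (π.appLE _ U'.1 e).hom.toAlgebra (isScalarTower_appLE f π e) _ (hf (V.affineBasicOpen g))
      s _ _ _ hspan' θ hθ i₀ hchart⟩
  · -- away from the center the blow-up is a local isomorphism
    obtain ⟨g, hgZ, hg⟩ := Set.not_subset.mp hZp
    have htop : Z.ideal (V.affineBasicOpen g) = ⊤ := by
      rw [← Z.map_ideal_basicOpen U g]
      have := hU.isLocalization_basicOpen g
      exact Ideal.eq_top_of_isUnit_mem _ (Ideal.mem_map_of_mem _ hgZ)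
        (IsLocalization.Away.algebraMap_isUnit (S := Γ(V, V.basicOpen g)) g)
    obtain ⟨U', e, hx', a, -, hchart⟩ := hπ.exists_chart x' (V.affineBasicOpen g)
      (mem_basicOpen_of_notMem_primeIdealOf hU hx hg) (Ideal.span_eq _)
    have hloc := @IsBlowupChart.isLocalization_away_of_eq_top _ _ _ _
      (π.appLE _ U'.1 e).hom.toAlgebra _ _ hchart htop
    exact ⟨U', hx', @HasProjectiveKaehler.of_isLocalizationAway k Γ(V, V.basicOpen g) Γ(V', U') _ _
      (sectionAlgebra f (V.basicOpen g)) _ (sectionAlgebra (π ≫ f) U'.1)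
      (π.appLE _ U'.1 e).hom.toAlgebra (isScalarTower_appLE f π e) (hf (V.affineBasicOpen g)) a
      hloc⟩

theorem IsBlowup.hasProjectiveKaehlerSheaf {f : V ⟶ Spec (.of k)} [Smooth f]
    {Z : V.IdealSheafData} [Smooth (Z.subschemeι ≫ f)] {π : V' ⟶ V} (hπ : IsBlowup π Z) :
    HasProjectiveKaehlerSheaf (π ≫ f) :=
  .of_cover _ hπ.exists_affineOpens_hasProjectiveKaehler

end BlowupKaehler

/-! ### Ideal sheaves: local comparison and quotients -/

namespace AlgebraicGeometry.Scheme.IdealSheafData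

variable {X Y : Scheme.{u}}

theorem le_of_forall_exists_affineOpens {I J : X.IdealSheafData}
    (h : ∀ x : X, ∃ U : X.affineOpens, x ∈ U.1 ∧ I.ideal U ≤ J.ideal U) : I ≤ J := by
  choose U hxU hU using h
  exact le_of_iSup_eq_top U
    (top_le_iff.mp fun x _ => TopologicalSpace.Opens.mem_iSup.mpr ⟨x, hxU x⟩) hU

theorem exists_affineOpens_le_preimage (f : X ⟶ Y) (x : X) :
    ∃ (U : Y.affineOpens) (W : X.affineOpens), W.1 ≤ f ⁻¹ᵁ U.1 ∧ x ∈ W.1 := by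
  obtain ⟨U, hU⟩ := exists_mem_affineOpens (f x)
  obtain ⟨_, ⟨W, hW, rfl⟩, hxW, hWU⟩ :=
    X.isBasis_affineOpens.exists_subset_of_mem_open (show x ∈ (f ⁻¹ᵁ U.1 : Set X) from hU)
      (f ⁻¹ᵁ U.1).isOpen
  exact ⟨U, ⟨W, hW⟩, hWU, hxW⟩

theorem comap_mul_comap_le (I J : Y.IdealSheafData) (f : X ⟶ Y) :
    I.comap f * J.comap f ≤ (I * J).comap f := by
  refine le_of_forall_exists_affineOpens fun x => ?_
  obtain ⟨U, W, e, hx⟩ := exists_affineOpens_le_preimage f x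
  refine ⟨W, hx, ?_⟩
  rw [ideal_mul, Pi.mul_apply, ideal_comap _ f U W e, ideal_comap _ f U W e, ideal_comap _ f U W e,
    ideal_mul, Pi.mul_apply, Ideal.map_mul]

/-- The quotient `I : K` of ideal sheaves, for `K` of finite type. -/
def colon (I K : X.IdealSheafData) (hK : ∀ U, (K.ideal U).FG) : X.IdealSheafData where
  ideal U := (I.ideal U).colon (K.ideal U : Set Γ(X, U))
  map_ideal_basicOpen U g := by
    have hU : IsAffineOpen U.1 := U.2
    have := hU.isLocalization_basicOpen g
    have h := Ideal.map_colon (B := Γ(X, X.basicOpen g)) (Submonoid.powers g) (I.ideal U) (hK U)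
    have hI := I.map_ideal_basicOpen U g
    have hK := K.map_ideal_basicOpen U g
    exact h.trans (congrArg₂ (fun a b : Ideal Γ(X, X.basicOpen g) => a.colon (b : Set _)) hI hK)

theorem le_colon_iff {I J K : X.IdealSheafData} {hK : ∀ U, (K.ideal U).FG} :
    J ≤ I.colon K hK ↔ J * K ≤ I :=
  forall_congr' fun _ => ⟨fun h => Ideal.mul_le.mpr fun _ hx y hy =>
    Submodule.mem_colon.mp (h hx) y hy, fun h _ hx =>
    Submodule.mem_colon.mpr fun _ hy => h (Ideal.mul_mem_mul hx hy)⟩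

end AlgebraicGeometry.Scheme.IdealSheafData

/-! ### The weighted transform -/

theorem IsFGFamily.of_affine_cover {X : Scheme.{u}} {I : ℕ → X.IdealSheafData} (hI0 : I 0 = ⊤)
    (hImul : ∀ m n, I m * I n ≤ I (m + n))
    (h : ∀ x : X, ∃ U : X.affineOpens, x ∈ U.1 ∧ IsFGFamily fun n => (I n).ideal U)
    (W : X.affineOpens) : IsFGFamily fun n => (I n).ideal W := by
  choose U hxU hU using h
  have h0 : ∀ U, (I 0).ideal U = ⊤ := fun U => by rw [hI0]; rfl
  refine of_affine_open_cover (P := fun U : X.affineOpens => IsFGFamily fun n => (I n).ideal U)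
    U ?_ W ?_ ?_ hU
  · exact top_le_iff.mp fun x _ => TopologicalSpace.Opens.mem_iSup.mpr ⟨x, hxU x⟩
  · intro U g hU
    have := IsFGFamily.map (B := Γ(X, X.basicOpen g)) (h0 U) (fun m n => hImul m n U) hU
    have heq : (fun n => (I n).ideal (X.affineBasicOpen g)) = fun n =>
        ((I n).ideal U).map (algebraMap Γ(X, U) Γ(X, X.basicOpen g)) :=
      funext fun n => ((I n).map_ideal_basicOpen U g).symm
    rw [heq]
    exact this
  · intro U s hs h
    have hU : IsAffineOpen U.1 := U.2
    refine @IsFGFamily.of_span_eq_top Γ(X, U) _ s s.finite_toSet hs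
      (fun r : (s : Set Γ(X, U)) => Γ(X, X.basicOpen r.1)) _ _
      (fun r => hU.isLocalization_basicOpen r.1) (fun n => (I n).ideal U) (h0 U)
      (fun m n => hImul m n U) fun r => ?_
    have heq : (fun n => (I n).ideal (X.affineBasicOpen r.1)) = fun n =>
        ((I n).ideal U).map (algebraMap Γ(X, U) Γ(X, X.basicOpen r.1)) :=
      funext fun n => ((I n).map_ideal_basicOpen U r.1).symm
    rw [← heq]
    exact h r

section Transform

variable {k : Type u} [Field k] {V V' : Scheme.{u}} {π : V' ⟶ V} {Z : V.IdealSheafData}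

theorem IsBlowup.exists_isBlowupChart (hπ : IsBlowup π Z) (x' : V') :
    ∃ (U : V.affineOpens) (U' : V'.affineOpens) (e : U'.1 ≤ π ⁻¹ᵁ U.1), x' ∈ U'.1 ∧
      ∃ a, letI := (π.appLE U.1 U'.1 e).hom.toAlgebra
        IsBlowupChart (Z.ideal U) a Γ(V', U') := by
  obtain ⟨U, hU⟩ := exists_mem_affineOpens (π x')
  obtain ⟨U', e, hx', a, -, h⟩ := hπ.exists_chart x' U hU (Ideal.span_eq _)
  exact ⟨U, U', e, hx', a, h⟩

/-- The ideal sheaf `I'ₙ = (Iₙ 𝒪_{V'} : I(H')ⁿ)` on the blow-up. -/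
def ReesAlg.transformIdeal (hnoeth : ∀ U' : V'.affineOpens, IsNoetherianRing Γ(V', U'))
    (π : V' ⟶ V) (Z : V.IdealSheafData) (𝒢 : ReesAlg V) (n : ℕ) : V'.IdealSheafData :=
  ((𝒢.I n).comap π).colon (Z.comap π ^ n)
    fun U' => (isNoetherianRing_iff_ideal_fg _).mp (hnoeth U') _

theorem ReesAlg.ideal_transformIdeal {hnoeth : ∀ U' : V'.affineOpens, IsNoetherianRing Γ(V', U')}
    {𝒢 : ReesAlg V} (n : ℕ) {U : V.affineOpens} {U' : V'.affineOpens} (e : U'.1 ≤ π ⁻¹ᵁ U.1) :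
    (𝒢.transformIdeal hnoeth π Z n).ideal U' =
      (((𝒢.I n).ideal U).map (π.appLE U.1 U'.1 e).hom).colon
        (((Z.ideal U).map (π.appLE U.1 U'.1 e).hom ^ n : Ideal Γ(V', U')) : Set Γ(V', U')) := by
  rw [← Scheme.IdealSheafData.ideal_comap _ π U U' e,
    ← Scheme.IdealSheafData.ideal_comap _ π U U' e]
  rfl

theorem ReesAlg.le_transformIdeal_iff
    (hnoeth : ∀ U' : V'.affineOpens, IsNoetherianRing Γ(V', U')) {𝒢 : ReesAlg V}
    {n : ℕ} {J : V'.IdealSheafData} :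
    J ≤ 𝒢.transformIdeal hnoeth π Z n ↔ J * Z.comap π ^ n ≤ (𝒢.I n).comap π :=
  Scheme.IdealSheafData.le_colon_iff

/-- The weighted transform of a Rees algebra `⨁ Iₙ Wⁿ` by the blow-up along `Z`. The condition that
the center lies in the singular locus enters in the form `Iₙ ⊆ Zⁿ`. -/
def ReesAlg.weightedTransform (hnoeth : ∀ U' : V'.affineOpens, IsNoetherianRing Γ(V', U'))
    (hπ : IsBlowup π Z) (𝒢 : ReesAlg V)
    (hle : ∀ (U : V.affineOpens) (n : ℕ), (𝒢.I n).ideal U ≤ Z.ideal U ^ n) : ReesAlg V' :=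
  have hT0 : 𝒢.transformIdeal hnoeth π Z 0 = ⊤ :=
    top_le_iff.mp <| (le_transformIdeal_iff hnoeth).mpr <| by
      rw [𝒢.I_zero, Scheme.IdealSheafData.comap_top]
      exact le_top
  have hTmul : ∀ m n, 𝒢.transformIdeal hnoeth π Z m * 𝒢.transformIdeal hnoeth π Z n ≤
      𝒢.transformIdeal hnoeth π Z (m + n) := fun m n => by
    refine (le_transformIdeal_iff hnoeth).mpr ?_
    rw [pow_add, mul_mul_mul_comm]
    exact (mul_le_mul' ((le_transformIdeal_iff hnoeth).mp le_rfl)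
      ((le_transformIdeal_iff hnoeth).mp le_rfl)).trans <|
      (Scheme.IdealSheafData.comap_mul_comap_le _ _ π).trans <|
        Scheme.IdealSheafData.comap_mono π (𝒢.mul_le m n)
  { I := 𝒢.transformIdeal hnoeth π Z
    I_zero := hT0
    mul_le := hTmul
    finite_gen := IsFGFamily.of_affine_cover hT0 hTmul fun x' => by
      obtain ⟨U, U', e, hx', a, h⟩ := hπ.exists_isBlowupChart x'
      refine ⟨U', hx', ?_⟩
      simp only [ideal_transformIdeal _ e]
      have h0 : (𝒢.I 0).ideal U = ⊤ := by rw [𝒢.I_zero]; rfl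
      let := (π.appLE U.1 U'.1 e).hom.toAlgebra
      exact h.isFGFamily_colon h0 (fun m n => 𝒢.mul_le m n U) (hle U) (𝒢.finite_gen U) }

variable {hnoeth : ∀ U' : V'.affineOpens, IsNoetherianRing Γ(V', U')} {𝒢 𝒦 : ReesAlg V}
  {hle : ∀ (U : V.affineOpens) (n : ℕ), (𝒢.I n).ideal U ≤ Z.ideal U ^ n}
  {hle' : ∀ (U : V.affineOpens) (n : ℕ), (𝒦.I n).ideal U ≤ Z.ideal U ^ n}

/-- The ideal sheaf of the exceptional divisor is invertible, so it can be cancelled. -/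
theorem IsBlowup.pow_mul_cancel (hπ : IsBlowup π Z) {n : ℕ} {X Y : V'.IdealSheafData}
    (h : Z.comap π ^ n * X ≤ Z.comap π ^ n * Y) : X ≤ Y := by
  refine Scheme.IdealSheafData.le_of_forall_exists_affineOpens fun x' => ?_
  obtain ⟨U, U', e, hx', a, hc⟩ := hπ.exists_isBlowupChart x'
  have hU := h U'
  simp only [Scheme.IdealSheafData.ideal_mul, Scheme.IdealSheafData.ideal_pow, Pi.mul_apply,
    Pi.pow_apply, Scheme.IdealSheafData.ideal_comap _ π U U' e] at hU
  exact ⟨U', hx', @IsBlowupChart.pow_mul_cancel _ _ _ _ (π.appLE U.1 U'.1 e).hom.toAlgebra _ _ hc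
    _ _ n hU⟩

theorem ReesAlg.isWeightedTransform_weightedTransform (hπ : IsBlowup π Z) :
    IsWeightedTransform π Z 𝒢 (𝒢.weightedTransform hnoeth hπ hle) := by
  intro n
  refine le_antisymm ?_ (by
    rw [mul_comm]
    exact (le_transformIdeal_iff hnoeth).mp le_rfl)
  refine Scheme.IdealSheafData.le_of_forall_exists_affineOpens fun x' => ?_
  obtain ⟨U, U', e, hx', a, hc⟩ := hπ.exists_isBlowupChart x'
  refine ⟨U', hx', ?_⟩
  change _ ≤ (Z.comap π ^ n).ideal U' * (𝒢.transformIdeal hnoeth π Z n).ideal U'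
  rw [ideal_transformIdeal n e, Scheme.IdealSheafData.ideal_pow, Pi.pow_apply,
    Scheme.IdealSheafData.ideal_comap _ π U U' e, Scheme.IdealSheafData.ideal_comap _ π U U' e]
  exact (@IsBlowupChart.map_eq_mul_colon _ _ _ _ (π.appLE U.1 U'.1 e).hom.toAlgebra _ _ hc _ n
    (hle U n)).le

/-- The weighted transform exists and is unique. -/
theorem ReesAlg.isWeightedTransform_iff (hπ : IsBlowup π Z) {𝒥 : ReesAlg V'} :
    IsWeightedTransform π Z 𝒢 𝒥 ↔ 𝒥 = 𝒢.weightedTransform hnoeth hπ hle := by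
  have hT := isWeightedTransform_weightedTransform (hnoeth := hnoeth) (hle := hle) hπ
  refine ⟨fun h => ReesAlg.ext (funext fun n => le_antisymm ?_ ?_), fun h => h ▸ hT⟩
  · exact hπ.pow_mul_cancel ((h n).symm.trans (hT n)).le
  · exact hπ.pow_mul_cancel ((hT n).symm.trans (h n)).le

theorem ReesAlg.weightedTransform_mono (hπ : IsBlowup π Z) (h : 𝒢 ≤ 𝒦) :
    𝒢.weightedTransform hnoeth hπ hle ≤ 𝒦.weightedTransform hnoeth hπ hle' := fun n =>
  (le_transformIdeal_iff hnoeth).mpr <| ((le_transformIdeal_iff hnoeth).mp le_rfl).trans <|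
    Scheme.IdealSheafData.comap_mono π (h n)

/-- The transform of a differential hull is contained in every Diff-algebra containing the transform
of the Rees algebra: on a chart with exceptional equation `a`, the elements of `Γ(V, U)` which lie
in `aⁿ Eₙ` form a differential family, by the chain rule. -/
theorem ReesAlg.weightedTransform_diffHull_le [CharZero k] {f : V ⟶ Spec (.of k)}
    (hf : HasProjectiveKaehlerSheaf f) (hf' : HasProjectiveKaehlerSheaf (π ≫ f))
    (hπ : IsBlowup π Z)
    {hle' : ∀ (U : V.affineOpens) (n : ℕ), ((𝒢.diffHull hf).I n).ideal U ≤ Z.ideal U ^ n}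
    {ℰ : ReesAlg V'} (hE : IsDiffAlgebra (π ≫ f) ℰ) (h : 𝒢.weightedTransform hnoeth hπ hle ≤ ℰ) :
    (𝒢.diffHull hf).weightedTransform hnoeth hπ hle' ≤ ℰ := by
  intro n
  refine Scheme.IdealSheafData.le_of_forall_exists_affineOpens fun x' => ?_
  obtain ⟨U, U', e, hx', a, hc⟩ := hπ.exists_isBlowupChart x'
  refine ⟨U', hx', ?_⟩
  have hEU := (isDiffAlgebra_iff hf').mp hE U'
  have hK := @IsBlowupChart.isDiffFamily_comap k Γ(V, U) Γ(V', U') _ _ (sectionAlgebra f U.1) _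
    (sectionAlgebra (π ≫ f) U'.1) (π.appLE U.1 U'.1 e).hom.toAlgebra (isScalarTower_appLE f π e)
    _ _ hc _ hEU
  have hT : ∀ m, ((𝒢.I m).ideal U).map (π.appLE U.1 U'.1 e).hom ≤
      Ideal.span {(π.appLE U.1 U'.1 e).hom a ^ m} * (ℰ.I m).ideal U' := by
    intro m
    have h1 := @IsBlowupChart.map_eq_mul_colon _ _ _ _ (π.appLE U.1 U'.1 e).hom.toAlgebra _ _ hc
      ((𝒢.I m).ideal U) m (hle U m)
    have h2 := @IsBlowupChart.map_eq _ _ _ _ _ _ (π.appLE U.1 U'.1 e).hom.toAlgebra hc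
    have h3 := h m U'
    change (𝒢.transformIdeal hnoeth π Z m).ideal U' ≤ _ at h3
    rw [ideal_transformIdeal m e] at h3
    refine h1.le.trans (Ideal.mul_mono (le_of_eq ?_) h3)
    rw [h2, Ideal.span_singleton_pow]
    rfl
  have hG := @diffHull_le k Γ(V, U) _ _ (sectionAlgebra f U.1) (fun m => (𝒢.I m).ideal U) _ hK
    (fun m => Ideal.map_le_iff_le_comap.mp (hT m)) n
  change ((𝒢.diffHull hf).transformIdeal hnoeth π Z n).ideal U' ≤ _
  rw [ideal_transformIdeal n e]
  intro z hz
  have hz' := Ideal.map_le_iff_le_comap.mpr hG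
    ((@IsBlowupChart.mem_colon_iff _ _ _ _ (π.appLE U.1 U'.1 e).hom.toAlgebra _ _ hc _ n z).mp hz)
  obtain ⟨y, hy, hyz⟩ := Ideal.mem_span_singleton_mul.mp hz'
  have := @IsBlowupChart.regular_pow _ _ _ _ (π.appLE U.1 U'.1 e).hom.toAlgebra _ _ hc n _ _ hyz
  rwa [← this]

end Transform

end

theorem mainTheorem2 {k : Type u} [Field k] [CharZero k]
    {V V' : Scheme.{u}} (f : V ⟶ Spec (.of k)) [Smooth f]
    (𝒢 : ReesAlg V)
    (Z : V.IdealSheafData) [Smooth (Z.subschemeι ≫ f)]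
    (hZ : (Z.support : Set V) ⊆ 𝒢.Sing)
    (π : V' ⟶ V) (hπ : IsBlowup π Z) :
    ∃ (G𝒢 : ReesAlg V) (𝒢' G𝒢' E F : ReesAlg V'),
      -- `G𝒢 = G(𝒢)`, and the transformation is permissible for it
      IsDiffHull f 𝒢 G𝒢 ∧ (Z.support : Set V) ⊆ G𝒢.Sing ∧
      -- `𝒢'` is the transform of `𝒢`, and `G𝒢'` is the transform of `G(𝒢)`
      (∀ 𝒥, IsWeightedTransform π Z 𝒢 𝒥 ↔ 𝒥 = 𝒢') ∧
      (∀ 𝒥, IsWeightedTransform π Z G𝒢 𝒥 ↔ 𝒥 = G𝒢') ∧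
      -- `E = G(𝒢')` and `F = G(G(𝒢)')`
      IsDiffHull (π ≫ f) 𝒢' E ∧ IsDiffHull (π ≫ f) G𝒢' F ∧
      -- the assertions
      𝒢' ≤ G𝒢' ∧ G𝒢' ≤ E ∧ E = F := by
  have hf := hasProjectiveKaehlerSheaf_of_smooth f
  have hf' := hπ.hasProjectiveKaehlerSheaf (f := f)
  have hZ' := hZ.trans (𝒢.Sing_subset_Sing_diffHull hf)
  have hle := ReesAlg.ideal_le_pow_of_support_subset_Sing f hZ
  have hle' := ReesAlg.ideal_le_pow_of_support_subset_Sing f hZ'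
  have hG := ReesAlg.isDiffHull_diffHull hf 𝒢
  let 𝒢' := 𝒢.weightedTransform hf'.isNoetherianRing hπ hle
  let G𝒢' := (𝒢.diffHull hf).weightedTransform hf'.isNoetherianRing hπ hle'
  have hE := ReesAlg.isDiffHull_diffHull hf' 𝒢'
  have hF := ReesAlg.isDiffHull_diffHull hf' G𝒢'
  have h1 : 𝒢' ≤ G𝒢' := ReesAlg.weightedTransform_mono hπ hG.1.2
  have h2 : G𝒢' ≤ 𝒢'.diffHull hf' := ReesAlg.weightedTransform_diffHull_le hf hf' hπ hE.1.1 hE.1.2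
  exact ⟨𝒢.diffHull hf, 𝒢', G𝒢', 𝒢'.diffHull hf', G𝒢'.diffHull hf', hG, hZ',
    fun _ => ReesAlg.isWeightedTransform_iff hπ, fun _ => ReesAlg.isWeightedTransform_iff hπ,
    hE, hF, h1, h2, le_antisymm (hE.2 ⟨hF.1.1, h1.trans hF.1.2⟩) (hF.2 ⟨hE.1.1, h2⟩)⟩
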